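/- **Setting.** Let $\mathcal{B}\subseteq\mathcal{A}$ be unital $C^*$-algebras (with the same unit), $\mathcal{B}$ finite-dimensional, and let $\Phi:\mathcal{A}\to\mathcal{B}$ be a $\mathcal{B}$-valued expectation, i.e. a linear map with $\Phi(a^*a)\ge 0$, $\Phi(1)=1$ and $\Phi(bab')=b\Phi(a)b'$ for $a\in\mathcal{A}$, $b,b'\in\mathcal{B}$. For $X\in\mathcal{A}$ let $\mathcal{B}\langle X\rangle_0$ be the set of finite sums of products $b_1Xb_2X\cdots Xb_k$ with $b_i\in\mathcal{B}$ and at least one factor $X$. A tuple $(Y_1,\dots,Y_r)$ in $\mathcal{A}$ is *monotonically independent* if $$\Phi(X_1\cdots X_m)=\Phi\bigl(X_1\cdots X_{p-1}\,\Phi(X_p)\,X_{p+1}\cdots X_m\bigr)$$ for all $m\ge1$, all $j_1,\dots,j_m\in\{1,\dots,r\}$, all $X_i\in\mathcal{B}\langle Y_{j_i}\rangle_0$, and all $p$ with $j_{p-1}<j_p>j_{p+1}$ (an inequality is dropped if $p=1$ or $p=m$). A family $(U_t)_{t\ge0}$ of unitaries of $\mathcal{A}$ is a *normalized unitary multiplicative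 monotone increment process (NUMIP)* if $U_0=1$, $\Phi(U_t)=e^{-t}1$ for all $t\ge0$, and $(U_{t_1}^*U_{t_2}-1,\dots,U_{t_{k-1}}^*U_{t_k}-1)$ is monotonically independent for all $k$ and all $0\le t_1\le\dots\le t_k$. The *distribution* of $U\in\mathcal{A}$ is the map $\mu:\mathcal{B}\langle X\rangle\to\mathcal{B}$, $\mu(p)=\Phi(p(U))$, on non-commutative polynomials over $\mathcal{B}$. Give $\mathcal{B}^{n\times n}$ its $C^*$-norm and let $\mathbb{B}_n$ be its open unit ball. For the distribution $\mu$ of a unitary $U$ and $z\in\mathbb{B}_n$ put $$\psi_\mu(z)=\sum_{m\ge1}\Phi\bigl((Uz)^m\bigr),\qquad \eta^n_\mu(z)=\psi_\mu(z)\,(1+\psi_\mu(z))^{-1},$$ with $\Phi$ applied entrywise. **Theorem.** Let $(U_t)_{t\ge0}$ be a NUMIP with distributions $(\mu_t)_{t\ge0}$, and let $n\in\mathbb{N}$. Then: 1. $(\eta^n_{\mu_t})_{t\ge0}$ is a normalized decreasing Loewner chain on $\mathbb{B}_n$: each $\eta^n_{\mu_t}$ is biholomorphic from $\mathbb{B}_n$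 onto its image, $\eta^n_{\mu_t}(\mathbb{B}_n)\subseteq\eta^n_{\mu_s}(\mathbb{B}_n)$ for $0\le s\le t$, $\eta^n_{\mu_0}(z)=z$ on $\mathbb{B}_n$, and $\eta^n_{\mu_t}(0)=0$, $D\eta^n_{\mu_t}(0)=e^{-t}I$ for all $t\ge0$. 2. It satisfies the Loewner PDE: there is a Herglotz vector field $M:\mathbb{B}_n\times[0,\infty)\to\mathcal{B}^{n\times n}$ such that for every $z\in\mathbb{B}_n$ the map $t\mapsto\eta^n_{\mu_t}(z)$ is locally absolutely continuous, and, for almost every $t\ge0$, $$\frac{\partial}{\partial t}\eta^n_{\mu_t}(z)=D\eta^n_{\mu_t}(z)\cdot M(z,t)\quad\text{for all } z\in\mathbb{B}_n,\qquad \eta^n_{\mu_0}(z)=z.$$ Here $M$ is a *Herglotz vector field* if $t\mapsto M(z,t)$ is measurable for each $z\in\mathbb{B}_n$ and, for each $t\ge0$, $h=M(\cdot,t)$ is holomorphic on $\mathbb{B}_n$ with $h(0)=0$, $Dh(0)=-I$, and $\operatorname{Re}\,l(h(z))<0$ for every $z\in\mathbb{B}_n\setminus\{0\}$ and every linear functional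 $l:\mathcal{B}^{n\times n}\to\mathbb{C}$ with $l(z)=\|z\|$, $\|l\|=1$. In particular each $\eta^n_{\mu_t}:\mathbb{B}_n\to\eta^n_{\mu_t}(\mathbb{B}_n)$ is biholomorphic. -/

import Mathlib

open Metric Set MeasureTheory

noncomputable section

/-! ### Loewner chains and the Loewner equation on the unit ball of a complex normed space -/

section Loewner

variable {E : Type*} [NormedAddCommGroup E] [NormedSpace ℂ E]

/-- `f` restricted to `s` is a biholomorphic map from `s` onto the open set `f '' s`: it is
holomorphic and has a holomorphic inverse defined on its image. -/
def IsBiholomorphicOntoImage (f : E → E) (s : Set E) : Prop :=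
  DifferentiableOn ℂ f s ∧ IsOpen (f '' s) ∧
    ∃ g : E → E, DifferentiableOn ℂ g (f '' s) ∧ ∀ z ∈ s, g (f z) = z

/-- `(f t)`, `t ≥ 0`, is a normalized decreasing Loewner chain on the open unit ball of `E`.
Only the values `f t z` with `0 ≤ t` and `‖z‖ < 1` matter. -/
structure IsNormalizedDecreasingLoewnerChain (f : ℝ → E → E) : Prop where
  biholomorphic : ∀ t, 0 ≤ t → IsBiholomorphicOntoImage (f t) (ball 0 1)
  decreasing : ∀ s t, 0 ≤ s → s ≤ t → f t '' ball 0 1 ⊆ f s '' ball 0 1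
  initial : ∀ z ∈ ball (0 : E) 1, f 0 z = z
  map_zero : ∀ t, 0 ≤ t → f t 0 = 0
  hasFDerivAt_zero : ∀ t, 0 ≤ t →
    HasFDerivAt (f t) (((Real.exp (-t) : ℝ) : ℂ) • ContinuousLinearMap.id ℂ E) 0

/-- The class of Herglotz functions on the open unit ball of `E`. -/
structure IsHerglotzFunction (h : E → E) : Prop where
  holomorphic : DifferentiableOn ℂ h (ball 0 1)
  map_zero : h 0 = 0
  hasFDerivAt_zero : HasFDerivAt h (-ContinuousLinearMap.id ℂ E) 0
  re_neg : ∀ z ∈ ball (0 : E) 1, z ≠ 0 → ∀ l : E →L[ℂ] ℂ,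
    l z = (‖z‖ : ℂ) → ‖l‖ = 1 → (l (h z)).re < 0

/-- `M z t`, for `‖z‖ < 1` and `t ≥ 0`, is a Herglotz vector field: a Herglotz function of `z` for
every `t`, and a measurable function of `t ∈ [0, ∞)` for every `z`. -/
structure IsHerglotzVectorField (M : E → ℝ → E) : Prop where
  herglotz : ∀ t, 0 ≤ t → IsHerglotzFunction (fun z => M z t)
  measurable : ∀ z ∈ ball (0 : E) 1, StronglyMeasurable (fun t : Ici (0 : ℝ) => M z t)

/-- `(f t)`, `t ≥ 0`, solves the Loewner equation
`∂f_t(z)/∂t = Df_t(z) · M(z,t)` for a.e. `t ≥ 0` and all `z` in the unit ball, `f_0(z) = z`.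
As usual for equations that hold almost everywhere in time, the solution is required to be locally
absolutely continuous in `t`. The exceptional null set of times does not depend on `z`. -/
structure SolvesLoewnerPDE (f : ℝ → E → E) (M : E → ℝ → E) : Prop where
  initial : ∀ z ∈ ball (0 : E) 1, f 0 z = z
  absolutelyContinuous : ∀ z ∈ ball (0 : E) 1, ∀ T, 0 ≤ T →
    AbsolutelyContinuousOnInterval (fun t => f t z) 0 T
  pde : ∀ᵐ t ∂(volume.restrict (Ici (0 : ℝ))), ∀ z ∈ ball (0 : E) 1,
    HasDerivAt (fun s => f s z) (fderiv ℂ (f t) z (M z t)) t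

end Loewner

/-! ### Non-commutative polynomials over an algebra -/

section NCPoly

variable (B : Type*) [Ring B] [Algebra ℂ B]

/-- The relations that make `B` a subalgebra of the algebra generated by the elements of `B`
(the letters `some b`) and one more letter `none`, the indeterminate. -/
inductive NCPolyRel : FreeAlgebra ℂ (Option B) → FreeAlgebra ℂ (Option B) → Prop
  | add (b c : B) : NCPolyRel (FreeAlgebra.ι ℂ (some (b + c)))
      (FreeAlgebra.ι ℂ (some b) + FreeAlgebra.ι ℂ (some c))
  | mul (b c : B) : NCPolyRel (FreeAlgebra.ι ℂ (some (b * c)))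
      (FreeAlgebra.ι ℂ (some b) * FreeAlgebra.ι ℂ (some c))
  | algebraMap (r : ℂ) : NCPolyRel (FreeAlgebra.ι ℂ (some (algebraMap ℂ B r)))
      (algebraMap ℂ (FreeAlgebra ℂ (Option B)) r)

/-- `B⟨X⟩`: the algebra of non-commutative polynomials in one indeterminate `X` with coefficients
in `B` (the coefficients do not commute with `X`). -/
abbrev NCPoly : Type _ := RingQuot (NCPolyRel B)

variable {B}

/-- The constant polynomial `b`. -/
def NCPoly.C (b : B) : NCPoly B :=
  RingQuot.mkAlgHom ℂ (NCPolyRel B) (FreeAlgebra.ι ℂ (some b))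

/-- The indeterminate. -/
def NCPoly.X : NCPoly B :=
  RingQuot.mkAlgHom ℂ (NCPolyRel B) (FreeAlgebra.ι ℂ none)

/-- Evaluation `p ↦ p(a)` at an element `a` of an algebra `A` which contains `B` through `j`. -/
def NCPoly.eval {A : Type*} [Ring A] [Algebra ℂ A] (j : B →ₐ[ℂ] A) (a : A) :
    NCPoly B →ₐ[ℂ] A :=
  RingQuot.liftAlgHom ℂ
    ⟨FreeAlgebra.lift ℂ (fun o : Option B => o.elim a j), by
      intro x y h
      cases h <;> simp⟩

theorem NCPoly.eval_C {A : Type*} [Ring A] [Algebra ℂ A] (j : B →ₐ[ℂ] A) (a : A) (b : B) :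
    NCPoly.eval j a (NCPoly.C b) = j b := by
  simp [NCPoly.eval, NCPoly.C]

theorem NCPoly.eval_X {A : Type*} [Ring A] [Algebra ℂ A] (j : B →ₐ[ℂ] A) (a : A) :
    NCPoly.eval j a NCPoly.X = a := by
  simp [NCPoly.eval, NCPoly.X]

end NCPoly

/-! ### Quantum probability spaces, distributions and transforms -/

/-- A `B`-valued quantum probability space `(A, B, Φ)`: unital C⋆-algebras `B ⊆ A` (the inclusion
is the unital ⋆-embedding `incl`) and a positive unital linear map `Φ : A → B` which is a
`B`-bimodule map. -/
structure QuantumProbabilitySpace (A B : Type*) [CStarAlgebra A]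
    [CStarAlgebra B] [PartialOrder B] [StarOrderedRing B] where
  incl : B →⋆ₐ[ℂ] A
  incl_injective : Function.Injective incl
  Φ : A →ₗ[ℂ] B
  Φ_nonneg : ∀ a, 0 ≤ Φ (star a * a)
  Φ_one : Φ 1 = 1
  Φ_bimodule : ∀ b b' a, Φ (incl b * a * incl b') = b * Φ a * b'

section Transforms

variable {B : Type*} [CStarAlgebra B] [PartialOrder B] [StarOrderedRing B]

/-- The moment generating function `ψ_μ(z) = ∑_{m ≥ 1} μ((X z)^m)` of `μ : B⟨X⟩ → B` on `n × n`
matrices over `B`. Here `X z` is the matrix with entries `X z_{ij}`, and `μ` is applied entrywise;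
if `μ` is the distribution of a unitary `U` then the summands are `Φ((U z)^m)`. -/
def psiTransform (μ : NCPoly B →ₗ[ℂ] B) (n : ℕ) (z : CStarMatrix (Fin n) (Fin n) B) :
    CStarMatrix (Fin n) (Fin n) B :=
  ∑' m : ℕ, CStarMatrix.ofMatrix
    (((Matrix.of fun i j => NCPoly.X * NCPoly.C (z i j)) ^ (m + 1)).map μ)

/-- The transform `η_μ = ψ_μ / (1 + ψ_μ)` on `n × n` matrices over `B`. -/
def etaTransform (μ : NCPoly B →ₗ[ℂ] B) (n : ℕ) (z : CStarMatrix (Fin n) (Fin n) B) :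
    CStarMatrix (Fin n) (Fin n) B :=
  psiTransform μ n z * Ring.inverse (1 + psiTransform μ n z)

end Transforms

namespace QuantumProbabilitySpace

variable {A B : Type*} [CStarAlgebra A] [CStarAlgebra B] [PartialOrder B] [StarOrderedRing B]
  (Q : QuantumProbabilitySpace A B)

/-- The distribution `μ_a : B⟨X⟩ → B`, `p ↦ Φ(p(a))`, of a random variable `a`. -/
def distribution (a : A) : NCPoly B →ₗ[ℂ] B :=
  Q.Φ ∘ₗ (NCPoly.eval (Q.incl : B →ₐ[ℂ] A) a).toLinearMap

/-- The `B`-subalgebra `B⟨x⟩₀` of `A`: the finite sums of products `b₁ x b₂ x ⋯ x b_k` with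
`b_i ∈ B` and at least one factor `x`. Such products are exactly the products of elements of the
form `b x b'`, so this is the non-unital subalgebra generated by the latter. -/
def generatedSubalgebra (x : A) : NonUnitalSubalgebra ℂ A :=
  NonUnitalAlgebra.adjoin ℂ {y | ∃ b b' : B, y = Q.incl b * x * Q.incl b'}

/-- Monotone independence of a family of (`B`-)subalgebras indexed by a linearly ordered set:
`Φ(X₁ ⋯ X_m) = Φ(X₁ ⋯ X_{p-1} Φ(X_p) X_{p+1} ⋯ X_m)` for `X_i` in the subalgebra number `j i`,
whenever `j (p-1) < j p > j (p+1)`, where one inequality is void if `p` is the first or the last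
position. -/
def MonotoneIndependent {I : Type*} [LinearOrder I] (S : I → NonUnitalSubalgebra ℂ A) : Prop :=
  ∀ (m : ℕ) (j : Fin m → I) (X : Fin m → A), (∀ i, X i ∈ S (j i)) →
    ∀ p : Fin m,
      (∀ q : Fin m, (q : ℕ) + 1 = p → j q < j p) →
      (∀ q : Fin m, (q : ℕ) = p + 1 → j q < j p) →
      Q.Φ (List.ofFn X).prod =
        Q.Φ (List.ofFn (Function.update X p (Q.incl (Q.Φ (X p))))).prod

/-- `(U t)`, `t ≥ 0`, is a normalized unitary multiplicative monotone increment process. Only the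
values at `t ≥ 0` matter. -/
structure IsNUMIP (U : ℝ → A) : Prop where
  unitary : ∀ t, 0 ≤ t → U t ∈ unitary A
  initial : U 0 = 1
  mean : ∀ t, 0 ≤ t → Q.Φ (U t) = algebraMap ℂ B ((Real.exp (-t) : ℝ) : ℂ)
  increments : ∀ (n : ℕ) (t : Fin (n + 1) → ℝ), 0 ≤ t 0 → Monotone t →
    Q.MonotoneIndependent fun i : Fin n =>
      Q.generatedSubalgebra (star (U (t i.castSucc)) * U (t i.succ) - 1)

end QuantumProbabilitySpace

end

/-!
The proof has an operator-algebraic and a function-theoretic half, which meet in the notion of an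
evolution family (`IsEvolutionFamily`).

For a unitary `V` put `P_V(z) = Φ((1 - V z)⁻¹) = 1 + ψ_V(z)`, so that `η_V = 1 - P_V⁻¹`. Everything
is proved for `1 × 1` matrices over an arbitrary quantum probability space; the matrix case is the
same statement for the space `amplification` of matrices over it, whose expectation is again
positive, the entrywise map being a bimodule map over matrices
(`CStarMatrix.nonneg_of_forall_diag`), and for the diagonal unitary with entries `V`. Three facts
are needed for the increments `V_{s,t} = U_s⋆ U_t`.

* The Schwarz lemma `‖η_V(z)‖ ≤ ‖z‖` (`norm_eta_le`). The resolvent `R = (1 - V z)⁻¹` satisfies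
  `(1 - ‖z‖²) R⋆ R ≤ R + R⋆ - 1`, and by the Kadison–Schwarz inequality so does `P_V(z)`; this also
  makes `P_V(z)` invertible.
* The bound `η_V(z) = z + O(t - s)` on smaller balls for `V = V_{s,t}` (`norm_eta_sub_le`). In the
  expansion of the resolvent to second order in `V - 1` the first order term has mean of order
  `1 - e^{-(t-s)}`, and so has the second one by the Cauchy–Schwarz inequality, because
  `Φ((V - 1)⋆ (V - 1)) = 2 (1 - e^{-(t-s)})`.
* Subordination `η_{UV} = η_U ∘ η_V` for monotonically independent `U - 1`, `V - 1`
  (`resolventMean_mul_of_centred`, `amplification_resolventMean_mul`). The resolvent of `UV` is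
  factored so that the centred resolvent of `V` stands between elements which begin or end with
  `U - 1`, and monotone independence, extended to closures, annihilates the mean of such products.

Hence `v s t = η_{V_{s,t}}` is an evolution family with `η_{μ_t} = v 0 t`. Over short times its maps
are close to the identity and therefore univalent on smaller balls; composition gives univalence for
all times (`IsEvolutionFamily.injOn`). The chain is Lipschitz in time, so that Rademacher's theorem
on a countable dense set of points, with equicontinuity in `z`, gives its differentiability for
almost every time at all points of the ball at once (`ae_forall_differentiableAt`). At such a time
`t` the difference quotients `(v t (t + τ) z - z) / τ` converge to a Herglotz function, which is the
vector field of the Loewner equation (`IsEvolutionFamily.loewner`); the Schwarz lemma gives the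
inequality `Re l(h(z)) ≤ 0`, and the maximum principle makes it strict.
-/

noncomputable section

open Filter Topology

/-! ### Cauchy estimates and limits of holomorphic maps -/

section Cauchy

variable {E F : Type*} [NormedAddCommGroup E] [NormedSpace ℂ E]
  [NormedAddCommGroup F] [NormedSpace ℂ F]

theorem norm_fderiv_le_of_forall_norm_le {f : E → F} {c : E} {R K : ℝ}
    (hd : DifferentiableOn ℂ f (ball c R)) (hK : ∀ z ∈ ball c R, ‖f z‖ ≤ K) (hR : 0 < R) :
    ‖fderiv ℂ f c‖ ≤ 2 * K / R := by
  refine Complex.norm_fderiv_le_div_of_mapsTo_ball hd (fun z hz => ?_) hR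
  rw [mem_closedBall, dist_eq_norm]
  linarith [norm_sub_le (f z) (f c), hK z hz, hK c (mem_ball_self hR)]

theorem norm_fderiv_le_of_mem_closedBall {f : E → F} {r R K : ℝ}
    (hd : DifferentiableOn ℂ f (ball 0 R)) (hK : ∀ z ∈ ball (0 : E) R, ‖f z‖ ≤ K) (hr : r < R)
    {x : E} (hx : ‖x‖ ≤ r) : ‖fderiv ℂ f x‖ ≤ 2 * K / (R - r) := by
  have hsub : ball x (R - r) ⊆ ball 0 R := ball_subset_ball' (by simp; linarith)
  exact norm_fderiv_le_of_forall_norm_le (hd.mono hsub) (fun z hz => hK z (hsub hz)) (by linarith)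

/-- The Cauchy estimate, as a Lipschitz bound on a smaller ball. -/
theorem norm_sub_le_of_forall_norm_le {f : E → F} {r R K : ℝ}
    (hd : DifferentiableOn ℂ f (ball 0 R)) (hK : ∀ z ∈ ball (0 : E) R, ‖f z‖ ≤ K) (hr : r < R)
    {x y : E} (hx : ‖x‖ ≤ r) (hy : ‖y‖ ≤ r) :
    ‖f y - f x‖ ≤ 2 * K / (R - r) * ‖y - x‖ := by
  refine Convex.norm_image_sub_le_of_norm_fderiv_le (𝕜 := ℂ) (s := closedBall (0 : E) r)
    (fun z hz => ?_) (fun z hz => ?_) (convex_closedBall _ _) (by simpa using hx)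
    (by simpa using hy)
  · exact hd.differentiableAt (isOpen_ball.mem_nhds (closedBall_subset_ball hr hz))
  · exact norm_fderiv_le_of_mem_closedBall hd hK hr (by simpa using hz)

/-- The second order Cauchy estimate. -/
theorem norm_sub_sub_fderiv_le {f : E → F} {c : E} {R K : ℝ}
    (hd : DifferentiableOn ℂ f (ball c R)) (hK : ∀ z ∈ ball c R, ‖f z‖ ≤ K) {z : E}
    (hz : z ∈ ball c R) :
    ‖f z - f c - fderiv ℂ f c (z - c)‖ ≤ 4 * K * (‖z - c‖ / R) ^ 2 := by
  have hR : 0 < R := nonempty_ball.mp ⟨_, hz⟩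
  set A := fderiv ℂ f c
  have hA : ‖A‖ ≤ 2 * K / R := norm_fderiv_le_of_forall_norm_le hd hK hR
  have hfc : HasFDerivAt f A c :=
    (hd.differentiableAt (isOpen_ball.mem_nhds (mem_ball_self hR))).hasFDerivAt
  have := Complex.dist_le_mul_div_pow_of_mapsTo_ball_of_isLittleO (n := 1)
    (f := fun w => f w - A (w - c)) (R₂ := 4 * K) (z := z) (c := c) (R₁ := R) ?_ ?_ ?_ hz
  · simpa [dist_eq_norm, sub_right_comm] using this
  · exact hd.sub (by fun_prop)
  · intro w hw
    rw [mem_closedBall, dist_eq_norm]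
    have h1 : ‖A (w - c)‖ ≤ 2 * K := by
      refine (A.le_opNorm _).trans ?_
      have : ‖w - c‖ ≤ R := (mem_ball_iff_norm.mp hw).le
      calc ‖A‖ * ‖w - c‖ ≤ 2 * K / R * R := by gcongr; exact (norm_nonneg A).trans hA
        _ = 2 * K := by field_simp
    have h2 := norm_sub_le (f w) (f c)
    have h3 := norm_sub_le (f w - f c) (A (w - c))
    simp only [sub_self, map_zero, sub_zero]
    rw [sub_right_comm]
    linarith [hK w hw, hK c (mem_ball_self hR)]
  · have := hfc.isLittleO
    simpa [sub_right_comm] using this.norm_right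

/-- A pointwise limit of uniformly bounded holomorphic maps is differentiable as soon as the
derivatives converge: the second order Taylor estimate is uniform along the family. -/
theorem hasFDerivAt_of_tendsto_of_norm_le {ι : Type*} {l : Filter ι} [l.NeBot] {g : ι → E → F}
    {h : E → F} {A : E →L[ℂ] F} {c : E} {R K : ℝ} (hR : 0 < R)
    (hd : ∀ i, DifferentiableOn ℂ (g i) (ball c R)) (hK : ∀ i, ∀ z ∈ ball c R, ‖g i z‖ ≤ K)
    (hg : ∀ z ∈ ball c R, Tendsto (fun i => g i z) l (𝓝 (h z)))
    (hA : Tendsto (fun i => fderiv ℂ (g i) c) l (𝓝 A)) : HasFDerivAt h A c := by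
  have key : ∀ z ∈ ball c R, ‖h z - h c - A (z - c)‖ ≤ 4 * K / R ^ 2 * ‖z - c‖ ^ 2 := by
    intro z hz
    have h1 : Tendsto (fun i => ‖g i z - g i c - fderiv ℂ (g i) c (z - c)‖) l
        (𝓝 ‖h z - h c - A (z - c)‖) :=
      (((hg z hz).sub (hg c (mem_ball_self hR))).sub
        (((ContinuousLinearMap.apply ℂ F (z - c)).continuous.tendsto A).comp hA)).norm
    refine le_of_tendsto h1 (Eventually.of_forall fun i => ?_)
    refine (norm_sub_sub_fderiv_le (hd i) (hK i) hz).trans_eq ?_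
    ring
  rw [hasFDerivAt_iff_isLittleO]
  have hO : (fun z => h z - h c - A (z - c)) =O[𝓝 c] fun z => ‖z - c‖ ^ 2 := by
    refine Asymptotics.IsBigO.of_bound (4 * K / R ^ 2) ?_
    filter_upwards [isOpen_ball.mem_nhds (mem_ball_self hR)] with z hz
    simpa using key z hz
  refine hO.trans_isLittleO ?_
  have := (Asymptotics.isLittleO_norm_pow_id (E' := E) (one_lt_two)).comp_tendsto
    (k := fun z => z - c) (l' := 𝓝 c) (by
      have : Tendsto (fun z : E => z - c) (𝓝 c) (𝓝 (c - c)) := tendsto_id.sub_const c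
      simpa using this)
  simpa [Function.comp_def] using this

/-- A pointwise limit of a uniformly bounded sequence of holomorphic maps is holomorphic: by
compactness the derivatives converge along a subsequence. -/
theorem differentiableAt_of_tendsto_of_norm_le [FiniteDimensional ℂ E] [FiniteDimensional ℂ F]
    {g : ℕ → E → F} {h : E → F} {c : E} {R K : ℝ} (hR : 0 < R)
    (hd : ∀ i, DifferentiableOn ℂ (g i) (ball c R)) (hK : ∀ i, ∀ z ∈ ball c R, ‖g i z‖ ≤ K)
    (hg : ∀ z ∈ ball c R, Tendsto (fun i => g i z) atTop (𝓝 (h z))) :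
    DifferentiableAt ℂ h c := by
  have : ProperSpace (E →L[ℂ] F) := FiniteDimensional.proper ℂ _
  obtain ⟨A, -, φ, hφ, hA⟩ := tendsto_subseq_of_bounded
    (isBounded_closedBall (x := (0 : E →L[ℂ] F)) (r := 2 * K / R))
    (x := fun i => fderiv ℂ (g i) c)
    (fun i => by simpa using norm_fderiv_le_of_forall_norm_le (hd i) (hK i) hR)
  exact (hasFDerivAt_of_tendsto_of_norm_le hR (fun i => hd (φ i)) (fun i => hK (φ i))
    (fun z hz => (hg z hz).comp hφ.tendsto_atTop) hA).differentiableAt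

end Cauchy

section Biholomorphic

variable {E : Type*} [NormedAddCommGroup E] [NormedSpace ℂ E] [FiniteDimensional ℂ E]

/-- The inverse function theorem for an injective map with injective derivatives. -/
theorem isOpen_image_and_hasFDerivAt_invFunOn {f : E → E} {s : Set E} (hs : IsOpen s)
    (hf : ContDiffOn ℂ 1 f s) (hinj : InjOn f s)
    (hder : ∀ z ∈ s, Function.Injective (fderiv ℂ f z)) :
    IsOpen (f '' s) ∧ ∀ z ∈ s, ∃ e : E ≃L[ℂ] E, (e : E →L[ℂ] E) = fderiv ℂ f z ∧
      HasFDerivAt (Function.invFunOn f s) (e.symm : E →L[ℂ] E) (f z) := by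
  have : CompleteSpace E := FiniteDimensional.complete ℂ E
  have hstrict : ∀ z ∈ s, ∃ e : E ≃L[ℂ] E, (e : E →L[ℂ] E) = fderiv ℂ f z ∧
      HasStrictFDerivAt f (e : E →L[ℂ] E) z := by
    intro z hz
    refine ⟨(LinearEquiv.ofInjectiveEndo _ (hder z hz)).toContinuousLinearEquiv, ?_⟩
    have he : (((LinearEquiv.ofInjectiveEndo _ (hder z hz)).toContinuousLinearEquiv :
        E ≃L[ℂ] E) : E →L[ℂ] E) = fderiv ℂ f z := by ext; rfl
    rw [he]
    exact ⟨rfl, (hf.contDiffAt (hs.mem_nhds hz)).hasStrictFDerivAt one_ne_zero⟩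
  refine ⟨?_, fun z hz => ?_⟩
  · rw [isOpen_iff_mem_nhds]
    rintro _ ⟨z, hz, rfl⟩
    obtain ⟨e, -, he⟩ := hstrict z hz
    rw [← he.map_nhds_eq_of_equiv]
    exact image_mem_map (hs.mem_nhds hz)
  · obtain ⟨e, h1, he⟩ := hstrict z hz
    refine ⟨e, h1, (he.to_local_left_inverse ?_).hasFDerivAt⟩
    filter_upwards [hs.mem_nhds hz] with x hx
    exact hinj.leftInvOn_invFunOn hx

theorem isBiholomorphicOntoImage_of_injOn {f : E → E} {s : Set E} (hs : IsOpen s)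
    (hf : ContDiffOn ℂ 1 f s) (hinj : InjOn f s)
    (hder : ∀ z ∈ s, Function.Injective (fderiv ℂ f z)) : IsBiholomorphicOntoImage f s := by
  obtain ⟨h1, h2⟩ := isOpen_image_and_hasFDerivAt_invFunOn hs hf hinj hder
  refine ⟨hf.differentiableOn one_ne_zero, h1, Function.invFunOn f s, ?_,
    fun z hz => hinj.leftInvOn_invFunOn hz⟩
  rintro _ ⟨z, hz, rfl⟩
  obtain ⟨e, -, he⟩ := h2 z hz
  exact he.differentiableAt.differentiableWithinAt

end Biholomorphic

/-! ### Evolution families: univalence and regularity in time -/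

section EvolutionFamily

variable {E : Type*} [NormedAddCommGroup E] [NormedSpace ℂ E]

/-- A (reversed) evolution family of the unit ball, `v s t` for `0 ≤ s ≤ t`: holomorphic self-maps
with `v r t = v r s ∘ v s t` which satisfy the conclusion of the Schwarz lemma, have derivative
`e^{-(t-s)}` at the origin and are `O(t - s)`-close to the identity, uniformly on smaller balls. The
chain attached to it is `v 0 t`. Holomorphy is stated as `ContDiffOn ℂ 1`, the form in which the
inverse function theorem uses it. -/
structure IsEvolutionFamily (v : ℝ → ℝ → E → E) : Prop where
  contDiffOn : ∀ s t, 0 ≤ s → s ≤ t → ContDiffOn ℂ 1 (v s t) (ball 0 1)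
  norm_le : ∀ s t, 0 ≤ s → s ≤ t → ∀ z ∈ ball (0 : E) 1, ‖v s t z‖ ≤ ‖z‖
  hasFDerivAt_zero : ∀ s t, 0 ≤ s → s ≤ t →
    HasFDerivAt (v s t) (((Real.exp (-(t - s)) : ℝ) : ℂ) • ContinuousLinearMap.id ℂ E) 0
  refl : ∀ s, 0 ≤ s → ∀ z ∈ ball (0 : E) 1, v s s z = z
  comp : ∀ r s t, 0 ≤ r → r ≤ s → s ≤ t → ∀ z ∈ ball (0 : E) 1, v r t z = v r s (v s t z)
  norm_sub_le : ∀ r < (1 : ℝ), ∃ C : ℝ, ∀ s t, 0 ≤ s → s ≤ t → ∀ z : E, ‖z‖ ≤ r →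
    ‖v s t z - z‖ ≤ C * (t - s)

namespace IsEvolutionFamily

variable {v : ℝ → ℝ → E → E} (hv : IsEvolutionFamily v)
include hv

theorem mem_ball {s t : ℝ} (hs : 0 ≤ s) (hst : s ≤ t) {z : E} (hz : z ∈ ball (0 : E) 1) :
    v s t z ∈ ball (0 : E) 1 := by
  rw [mem_ball_zero_iff] at *
  exact (hv.norm_le s t hs hst z (by simpa using hz)).trans_lt hz

theorem differentiableOn {s t : ℝ} (hs : 0 ≤ s) (hst : s ≤ t) :
    DifferentiableOn ℂ (v s t) (ball 0 1) :=
  (hv.contDiffOn s t hs hst).differentiableOn one_ne_zero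

theorem differentiableAt {s t : ℝ} (hs : 0 ≤ s) (hst : s ≤ t) {z : E} (hz : z ∈ ball (0 : E) 1) :
    DifferentiableAt ℂ (v s t) z :=
  (hv.differentiableOn hs hst).differentiableAt (isOpen_ball.mem_nhds hz)

theorem norm_le_one {s t : ℝ} (hs : 0 ≤ s) (hst : s ≤ t) {z : E} (hz : z ∈ ball (0 : E) 1) :
    ‖v s t z‖ ≤ 1 := (mem_ball_zero_iff.mp (hv.mem_ball hs hst hz)).le

theorem map_zero {s t : ℝ} (hs : 0 ≤ s) (hst : s ≤ t) : v s t 0 = 0 := by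
  simpa using hv.norm_le s t hs hst 0 (by simp)

theorem exists_norm_sub_le {r : ℝ} (hr : r < 1) : ∃ C : ℝ, 0 ≤ C ∧ ∀ s t, 0 ≤ s → s ≤ t →
    ∀ z : E, ‖z‖ ≤ r → ‖v s t z - z‖ ≤ C * (t - s) := by
  obtain ⟨C, hC⟩ := hv.norm_sub_le r hr
  refine ⟨|C|, abs_nonneg _, fun s t hs hst z hz => (hC s t hs hst z hz).trans ?_⟩
  exact mul_le_mul_of_nonneg_right (le_abs_self C) (sub_nonneg.mpr hst)

/-- Over short time intervals the maps of an evolution family are close to the identity on a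
smaller ball, and hence univalent there. -/
theorem exists_injOn_of_sub_le {r : ℝ} (hr : r < 1) : ∃ δ > 0, ∀ s t, 0 ≤ s → s ≤ t → t - s ≤ δ →
    InjOn (v s t) (closedBall 0 r) ∧
      ∀ z ∈ closedBall (0 : E) r, Function.Injective (fderiv ℂ (v s t) z) := by
  set R := (1 + r) / 2 with hR
  have hrR : 0 < R - r := by rw [hR]; linarith
  have hR1 : R < 1 := by rw [hR]; linarith
  obtain ⟨C, hC0, hC⟩ := hv.exists_norm_sub_le hR1
  refine ⟨(R - r) / (4 * (C + 1)), by positivity, fun s t hs hst hδ => ?_⟩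
  have hK : 2 * (C * (t - s)) / (R - r) ≤ 1 / 2 := by
    rw [div_le_div_iff₀ hrR two_pos]
    rw [le_div_iff₀ (by positivity)] at hδ
    nlinarith
  have hsub : ball (0 : E) R ⊆ ball 0 1 := ball_subset_ball hR1.le
  have hd : DifferentiableOn ℂ (fun z => v s t z - z) (ball 0 R) :=
    ((hv.differentiableOn hs hst).mono hsub).sub differentiableOn_id
  have hb : ∀ z ∈ ball (0 : E) R, ‖v s t z - z‖ ≤ C * (t - s) := fun z hz =>
    hC s t hs hst z (mem_ball_zero_iff.mp hz).le
  constructor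
  · intro x hx y hy hxy
    have := norm_sub_le_of_forall_norm_le hd hb (sub_pos.mp hrR) (x := x) (y := y)
      (by simpa using hx) (by simpa using hy)
    rw [hxy, sub_sub_sub_cancel_left, norm_sub_rev] at this
    have h2 : ‖y - x‖ ≤ 1 / 2 * ‖y - x‖ := this.trans (by gcongr)
    have h3 : ‖y - x‖ = 0 := by linarith [norm_nonneg (y - x)]
    exact (sub_eq_zero.mp (norm_eq_zero.mp h3)).symm
  · intro z hz
    have hzR : z ∈ ball (0 : E) 1 := closedBall_subset_ball hr hz
    have hfd := norm_fderiv_le_of_mem_closedBall hd hb (sub_pos.mp hrR) (x := z) (by simpa using hz)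
    rw [fderiv_fun_sub (hv.differentiableAt hs hst hzR) differentiableAt_fun_id] at hfd
    rw [injective_iff_map_eq_zero]
    intro w hw
    have h1 := ContinuousLinearMap.le_opNorm (fderiv ℂ (v s t) z - fderiv ℂ (fun y : E => y) z) w
    rw [fderiv_fun_id] at hfd h1
    simp only [sub_apply, hw, ContinuousLinearMap.id_apply, zero_sub, norm_neg] at h1
    have h2 : ‖w‖ ≤ 1 / 2 * ‖w‖ := h1.trans (by gcongr; exact hfd.trans hK)
    exact norm_eq_zero.mp (by linarith [norm_nonneg w])

/-- Univalence on a smaller ball for all pairs of times: `v s t` is a composition of finitely many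
maps over short time intervals, each of which maps the smaller ball into itself. -/
theorem injOn_closedBall {r : ℝ} (hr : r < 1) {s t : ℝ} (hs : 0 ≤ s) (hst : s ≤ t) :
    InjOn (v s t) (closedBall 0 r) ∧
      ∀ z ∈ closedBall (0 : E) r, Function.Injective (fderiv ℂ (v s t) z) := by
  obtain ⟨δ, hδ, h⟩ := hv.exists_injOn_of_sub_le hr
  have key : ∀ n : ℕ, ∀ s t, 0 ≤ s → s ≤ t → t - s ≤ n * δ → InjOn (v s t) (closedBall 0 r) ∧
      ∀ z ∈ closedBall (0 : E) r, Function.Injective (fderiv ℂ (v s t) z) := by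
    intro n
    induction n with
    | zero => exact fun s t hs hst hn => h s t hs hst (hn.trans (by simpa using hδ.le))
    | succ n ih =>
      intro s t hs hst hn
      push_cast at hn
      have hsm : s ≤ max s (t - δ) := le_max_left _ _
      have hmt : max s (t - δ) ≤ t := max_le hst (by linarith)
      generalize hm : max s (t - δ) = m at hsm hmt
      have hms : m - s ≤ n * δ := by
        rw [← hm, ← max_sub_sub_right]
        exact max_le (by rw [sub_self]; positivity) (by linarith)
      have htm : t - m ≤ δ := by linarith [le_max_right s (t - δ)]
      obtain ⟨i1, d1⟩ := ih s m hs hsm hms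
      obtain ⟨i2, d2⟩ := h m t (hs.trans hsm) hmt htm
      have hball : closedBall (0 : E) r ⊆ ball 0 1 := closedBall_subset_ball hr
      have hmaps : MapsTo (v m t) (closedBall 0 r) (closedBall 0 r) := fun z hz => by
        have := hv.norm_le m t (hs.trans hsm) hmt z (hball hz)
        simp only [mem_closedBall_zero_iff] at hz ⊢
        exact this.trans hz
      constructor
      · refine (i1.comp i2 hmaps).congr fun z hz => ?_
        exact (hv.comp s m t hs hsm hmt z (hball hz)).symm
      · intro z hz
        have heq : v s t =ᶠ[𝓝 z] v s m ∘ v m t := by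
          filter_upwards [isOpen_ball.mem_nhds (hball hz)] with x hx
          exact hv.comp s m t hs hsm hmt x hx
        rw [heq.fderiv_eq, fderiv_comp z (hv.differentiableAt hs hsm (hball (hmaps hz)))
          (hv.differentiableAt (hs.trans hsm) hmt (hball hz))]
        exact (d1 _ (hmaps hz)).comp (d2 z hz)
  obtain ⟨n, hn⟩ := exists_nat_ge ((t - s) / δ)
  exact key n s t hs hst ((div_le_iff₀ hδ).mp hn)

theorem injOn {s t : ℝ} (hs : 0 ≤ s) (hst : s ≤ t) : InjOn (v s t) (ball 0 1) := by
  intro x hx y hy hxy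
  rw [mem_ball_zero_iff] at hx hy
  exact (hv.injOn_closedBall (max_lt hx hy) hs hst).1 (by simp) (by simp) hxy

theorem injective_fderiv {s t : ℝ} (hs : 0 ≤ s) (hst : s ≤ t) {z : E} (hz : z ∈ ball (0 : E) 1) :
    Function.Injective (fderiv ℂ (v s t) z) :=
  (hv.injOn_closedBall (mem_ball_zero_iff.mp hz) hs hst).2 z (by simp)

/-- Lipschitz continuity in the later time. -/
theorem exists_lipschitz_right {r : ℝ} (hr : r < 1) : ∃ L : ℝ, 0 ≤ L ∧ ∀ q s t, 0 ≤ q → q ≤ s →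
    s ≤ t → ∀ z : E, ‖z‖ ≤ r → ‖v q t z - v q s z‖ ≤ L * (t - s) := by
  obtain ⟨C, hC0, hC⟩ := hv.exists_norm_sub_le hr
  have hr' : 0 < 1 - r := by linarith
  refine ⟨2 * 1 / (1 - r) * C, by positivity, fun q s t hq hqs hst z hz => ?_⟩
  have hzb : z ∈ ball (0 : E) 1 := mem_ball_zero_iff.mpr (hz.trans_lt hr)
  rw [hv.comp q s t hq hqs hst z hzb, mul_assoc]
  refine (norm_sub_le_of_forall_norm_le (hv.differentiableOn hq hqs)
    (fun x hx => hv.norm_le_one hq hqs hx) hr hz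
    ((hv.norm_le s t (hq.trans hqs) hst z hzb).trans hz)).trans ?_
  gcongr
  exact hC s t (hq.trans hqs) hst z hz

/-- Lipschitz continuity under a simultaneous translation of both times. -/
theorem exists_lipschitz_shift {r : ℝ} (hr : r < 1) : ∃ L : ℝ, 0 ≤ L ∧ ∀ h s t, 0 ≤ h → 0 ≤ s →
    s ≤ t → ∀ z : E, ‖z‖ ≤ r → ‖v t (t + h) z - v s (s + h) z‖ ≤ L * (t - s) := by
  obtain ⟨C, hC0, hC⟩ := hv.exists_norm_sub_le hr
  obtain ⟨L, hL0, hL⟩ := hv.exists_lipschitz_right hr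
  refine ⟨C + L, by positivity, fun h s t hh hs hst z hz => ?_⟩
  have hzb : z ∈ ball (0 : E) 1 := mem_ball_zero_iff.mpr (hz.trans_lt hr)
  have h1 := hC s t hs hst (v t (t + h) z)
    ((hv.norm_le t (t + h) (hs.trans hst) (by linarith) z hzb).trans hz)
  rw [← hv.comp s t (t + h) hs hst (by linarith) z hzb, norm_sub_rev] at h1
  have h2 := hL s (s + h) (t + h) hs (by linarith) (by linarith) z hz
  calc ‖v t (t + h) z - v s (s + h) z‖
      = ‖(v t (t + h) z - v s (t + h) z) + (v s (t + h) z - v s (s + h) z)‖ := by congr 1; abel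
    _ ≤ _ := norm_add_le _ _
    _ ≤ C * (t - s) + L * (t + h - (s + h)) := add_le_add h1 h2
    _ = (C + L) * (t - s) := by ring

theorem continuous_shift {h : ℝ} (hh : 0 ≤ h) {z : E} (hz : z ∈ ball (0 : E) 1) :
    Continuous fun t : Ici (0 : ℝ) => v t (t + h) z := by
  obtain ⟨L, hL0, hL⟩ := hv.exists_lipschitz_shift (mem_ball_zero_iff.mp hz)
  refine (LipschitzWith.of_dist_le_mul (K := L.toNNReal) fun t s => ?_).continuous
  rw [Subtype.dist_eq, dist_eq_norm, Real.dist_eq, Real.coe_toNNReal _ hL0]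
  rcases le_total (s : ℝ) t with h1 | h1
  · rw [abs_of_nonneg (sub_nonneg.mpr h1)]
    exact hL h s t hh s.2 h1 z le_rfl
  · rw [norm_sub_rev, abs_sub_comm, abs_of_nonneg (sub_nonneg.mpr h1)]
    exact hL h t s hh t.2 h1 z le_rfl

/-- Lipschitz continuity of the chain in time, for the extension by a constant to negative times. -/
theorem exists_lipschitzWith {r : ℝ} (hr : r < 1) : ∃ L : NNReal, ∀ z : E, ‖z‖ ≤ r →
    LipschitzWith L fun t => v 0 (max t 0) z := by
  obtain ⟨L, hL0, hL⟩ := hv.exists_lipschitz_right hr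
  refine ⟨L.toNNReal, fun z hz => ?_⟩
  have key : ∀ s t : ℝ, s ≤ t →
      ‖v 0 (max t 0) z - v 0 (max s 0) z‖ ≤ L * (t - s) := by
    intro s t h
    refine (hL 0 (max s 0) (max t 0) le_rfl (le_max_right _ _)
      (max_le_max_right 0 h) z hz).trans ?_
    refine mul_le_mul_of_nonneg_left ?_ hL0
    rcases max_cases t 0 with h0 | h0 <;> rcases max_cases s 0 with h1 | h1 <;> linarith
  refine LipschitzWith.of_dist_le_mul fun t s => ?_
  rw [dist_eq_norm, Real.dist_eq, Real.coe_toNNReal _ hL0]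
  rcases le_total s t with h1 | h1
  · rw [abs_of_nonneg (sub_nonneg.mpr h1)]
    exact key s t h1
  · rw [norm_sub_rev, abs_sub_comm, abs_of_nonneg (sub_nonneg.mpr h1)]
    exact key t s h1

end IsEvolutionFamily
end EvolutionFamily

/-! ### Herglotz functions and the Loewner equation of an evolution family -/

theorem exists_tendsto_of_forall_approx {ι E : Type*} [NormedAddCommGroup E] [CompleteSpace E]
    {l : Filter ι} [l.NeBot] {q : ι → E}
    (h : ∀ ε > 0, ∃ w, ∀ᶠ i in l, ‖q i - w‖ < ε) : ∃ w, Tendsto q l (𝓝 w) := by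
  refine cauchy_map_iff_exists_tendsto.mp (Metric.cauchy_iff.mpr ⟨inferInstance, fun ε hε => ?_⟩)
  obtain ⟨w, hw⟩ := h (ε / 2) (half_pos hε)
  refine ⟨ball w (ε / 2), ?_, fun x hx y hy => ?_⟩
  · refine mem_map.mpr ?_
    filter_upwards [hw] with i hi
    simpa [dist_eq_norm] using hi
  · calc dist x y ≤ dist x w + dist y w := dist_triangle_right _ _ _
      _ < ε / 2 + ε / 2 := add_lt_add hx hy
      _ = ε := add_halves ε

section Herglotz

variable {E : Type*} [NormedAddCommGroup E] [NormedSpace ℂ E]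

theorem isHerglotzFunction_neg : IsHerglotzFunction (fun z : E => -z) where
  holomorphic := differentiableOn_id.neg
  map_zero := neg_zero
  hasFDerivAt_zero := (hasFDerivAt_id (𝕜 := ℂ) (0 : E)).neg
  re_neg z _ hz l hl _ := by
    rw [map_neg, hl]
    simpa using hz

/-- The strict inequality in the definition of a Herglotz function follows from the weak one. On the
complex line through `z` the function `φ ζ = l (h (ζ u)) / ζ`, with `u` the direction of `z`, has
nonpositive real part and `φ 0 = -1`, so that by the maximum principle for `exp ∘ φ` its real part
does not vanish. -/
theorem re_neg_of_re_nonpos {h : E → E} (hd : DifferentiableOn ℂ h (ball 0 1)) (h0 : h 0 = 0)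
    (hD : HasFDerivAt h (-ContinuousLinearMap.id ℂ E) 0)
    (hle : ∀ z ∈ ball (0 : E) 1, z ≠ 0 → ∀ l : E →L[ℂ] ℂ, l z = (‖z‖ : ℂ) → ‖l‖ = 1 →
      (l (h z)).re ≤ 0)
    {z : E} (hz : z ∈ ball (0 : E) 1) (hz0 : z ≠ 0) (l : E →L[ℂ] ℂ) (hl : l z = (‖z‖ : ℂ))
    (hl1 : ‖l‖ = 1) : (l (h z)).re < 0 := by
  have hzn : 0 < ‖z‖ := norm_pos_iff.mpr hz0
  have hzn' : (‖z‖ : ℂ) ≠ 0 := by exact_mod_cast hzn.ne'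
  set u : E := (‖z‖ : ℂ)⁻¹ • z with hu
  have hun : ‖u‖ = 1 := by simp [hu, norm_smul, hzn.ne']
  have hlu : l u = 1 := by simp [hu, hl, hzn']
  have hzu : (‖z‖ : ℂ) • u = z := by simp [hu, smul_smul, hzn']
  set φ : ℂ → ℂ := dslope (fun ζ => l (h (ζ • u))) 0 with hφ
  have hmaps : MapsTo (fun ζ : ℂ => ζ • u) (ball 0 1) (ball 0 1) := fun ζ hζ => by
    simpa [norm_smul, hun] using hζ
  have hφd : DifferentiableOn ℂ φ (ball 0 1) := by
    rw [hφ, Complex.differentiableOn_dslope (ball_mem_nhds 0 one_pos)]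
    exact l.differentiable.comp_differentiableOn (hd.comp (by fun_prop) hmaps)
  have hφ0 : φ 0 = -1 := by
    rw [hφ, dslope_same]
    have h1 : HasDerivAt (fun ζ : ℂ => ζ • u) ((1 : ℂ) • u) 0 := (hasDerivAt_id 0).smul_const u
    have h2 : HasFDerivAt h (-ContinuousLinearMap.id ℂ E) ((0 : ℂ) • u) := by
      rwa [zero_smul]
    have h3 := (l.hasFDerivAt.comp _ h2).comp_hasDerivAt (0 : ℂ) h1
    have h4 := h3.deriv
    simpa [Function.comp_def, hlu] using h4
  have hφne : ∀ ζ ≠ 0, φ ζ = ζ⁻¹ * l (h (ζ • u)) := fun ζ hζ => by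
    rw [hφ, dslope_of_ne _ hζ, slope_def_field]
    simp [h0, div_eq_inv_mul]
  have hφle : ∀ ζ ∈ ball (0 : ℂ) 1, (φ ζ).re ≤ 0 := by
    intro ζ hζ
    rcases eq_or_ne ζ 0 with rfl | hζ0
    · rw [hφ0]; simp
    have hζn : (‖ζ‖ : ℂ) ≠ 0 := by simpa using hζ0
    -- the supporting functional at `ζ • u` is `l` rotated by the phase of `ζ`
    have h1 := hle (ζ • u) (hmaps hζ) (smul_ne_zero hζ0 (by rintro h; simp [h] at hun))
      (((‖ζ‖ : ℂ) * ζ⁻¹) • l) (by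
        simp only [smul_apply, map_smul, hlu, norm_smul, hun, smul_eq_mul]
        field_simp) (by simp [norm_smul, hl1, hζ0])
    have h2 : φ ζ = ((‖ζ‖⁻¹ : ℝ) : ℂ) * ((((‖ζ‖ : ℂ) * ζ⁻¹) • l) (h (ζ • u))) := by
      rw [hφne ζ hζ0, Complex.ofReal_inv, smul_apply, smul_eq_mul, mul_assoc,
        inv_mul_cancel_left₀ hζn]
    rw [h2, Complex.re_ofReal_mul]
    exact mul_nonpos_of_nonneg_of_nonpos (by positivity) h1
  by_contra! hcon
  have hzmem : (‖z‖ : ℂ) ∈ ball (0 : ℂ) 1 := by simpa using hz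
  have hφz : φ ‖z‖ = ((‖z‖⁻¹ : ℝ) : ℂ) * l (h z) := by
    rw [hφne _ hzn', hzu, Complex.ofReal_inv]
  have hφz0 : 0 ≤ (φ ‖z‖).re := by
    rw [hφz, Complex.re_ofReal_mul]
    positivity
  have hmax : IsMaxOn (norm ∘ fun ζ => Complex.exp (φ ζ)) (ball 0 1) (‖z‖ : ℂ) := by
    intro ζ hζ
    simp only [Function.comp_apply, Complex.norm_exp, mem_ofPred_eq, Real.exp_le_exp]
    exact (hφle ζ hζ).trans hφz0
  have := Complex.norm_eqOn_of_isPreconnected_of_isMaxOn (convex_ball (0 : ℂ) 1).isPreconnected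
    isOpen_ball hφd.cexp hzmem hmax (mem_ball_self one_pos)
  simp only [Function.comp_apply, Function.const_apply, Complex.norm_exp, Real.exp_eq_exp, hφ0]
    at this
  rw [← this] at hφz0
  norm_num at hφz0

end Herglotz

section EvolutionFamily

variable {E : Type*} [NormedAddCommGroup E] [NormedSpace ℂ E]

/-- The difference quotients `(v t (t + τ) z - z) / τ` of an evolution family at time `t`, for the
steps `τ = 1 / (k + 1)`. -/
def rightQuotient (v : ℝ → ℝ → E → E) (k : ℕ) (t : ℝ) (z : E) : E :=
  ((k : ℂ) + 1) • (v t (t + ((k : ℝ) + 1)⁻¹) z - z)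

theorem tendsto_natCast_add_one_inv :
    Tendsto (fun k : ℕ => ((k : ℝ) + 1)⁻¹) atTop (𝓝 0) := by
  simpa using tendsto_one_div_add_atTop_nhds_zero_nat (𝕜 := ℝ)

theorem tendsto_mul_exp_sub_one :
    Tendsto (fun k : ℕ => ((k : ℝ) + 1) * (Real.exp (-((k : ℝ) + 1)⁻¹) - 1)) atTop (𝓝 (-1)) := by
  have h := hasDerivAt_iff_tendsto_slope.mp (Real.hasDerivAt_exp 0)
  have h1 : Tendsto (fun k : ℕ => -((k : ℝ) + 1)⁻¹) atTop (𝓝[≠] 0) := by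
    refine tendsto_nhdsWithin_iff.mpr ⟨?_, Eventually.of_forall fun k => ?_⟩
    · simpa using (tendsto_natCast_add_one_inv).neg
    · simp only [mem_compl_iff, mem_singleton_iff, neg_eq_zero, inv_eq_zero]
      positivity
  have h2 := (h.comp h1).neg
  simp only [Real.exp_zero] at h2
  refine h2.congr fun k => ?_
  simp only [Function.comp_apply, slope_def_field, Real.exp_zero, sub_zero]
  rw [div_neg, neg_neg, div_inv_eq_mul, mul_comm]

namespace IsEvolutionFamily

variable {v : ℝ → ℝ → E → E} (hv : IsEvolutionFamily v)
include hv

theorem differentiableOn_rightQuotient (k : ℕ) {t : ℝ} (ht : 0 ≤ t) :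
    DifferentiableOn ℂ (rightQuotient v k t) (ball 0 1) :=
  ((hv.differentiableOn ht (le_add_of_nonneg_right (by positivity))).sub
    differentiableOn_id).const_smul ((k : ℂ) + 1)

theorem exists_norm_rightQuotient_le {r : ℝ} (hr : r < 1) : ∃ C : ℝ, ∀ k t, 0 ≤ t → ∀ z : E,
    ‖z‖ ≤ r → ‖rightQuotient v k t z‖ ≤ C := by
  obtain ⟨C, -, hC⟩ := hv.exists_norm_sub_le hr
  refine ⟨C, fun k t ht z hz => ?_⟩
  have hk : ‖(k : ℂ) + 1‖ = k + 1 := by exact_mod_cast Complex.norm_natCast (k + 1)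
  have hk0 : (0 : ℝ) < k + 1 := by positivity
  rw [rightQuotient, norm_smul, hk]
  have h1 := hC t (t + ((k : ℝ) + 1)⁻¹) ht (le_add_of_nonneg_right (by positivity)) z hz
  calc ((k : ℝ) + 1) * ‖v t (t + ((k : ℝ) + 1)⁻¹) z - z‖
      ≤ (k + 1) * (C * (t + ((k : ℝ) + 1)⁻¹ - t)) := by gcongr
    _ = C := by field_simp; ring

/-- Limits of the difference quotients are Herglotz functions: the Schwarz lemma
`‖v t (t + τ) z‖ ≤ ‖z‖` gives the weak inequality. -/
theorem isHerglotzFunction_of_tendsto [FiniteDimensional ℂ E] {t : ℝ} (ht : 0 ≤ t) {h : E → E}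
    (hh : ∀ z ∈ ball (0 : E) 1, Tendsto (fun k => rightQuotient v k t z) atTop (𝓝 (h z))) :
    IsHerglotzFunction h := by
  have hle : ∀ k : ℕ, t ≤ t + ((k : ℝ) + 1)⁻¹ := fun k =>
    le_add_of_nonneg_right (by positivity)
  have hd : DifferentiableOn ℂ h (ball 0 1) := by
    intro c hc
    rw [mem_ball_zero_iff] at hc
    have hsub : ball c ((1 - ‖c‖) / 2) ⊆ ball 0 ((1 + ‖c‖) / 2) :=
      ball_subset_ball' (by rw [dist_zero_right]; linarith)
    have hsub1 : ball (0 : E) ((1 + ‖c‖) / 2) ⊆ ball 0 1 := ball_subset_ball (by linarith)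
    obtain ⟨C, hC⟩ := hv.exists_norm_rightQuotient_le (r := (1 + ‖c‖) / 2) (by linarith)
    exact (differentiableAt_of_tendsto_of_norm_le (R := (1 - ‖c‖) / 2) (by linarith)
      (fun k => (hv.differentiableOn_rightQuotient k ht).mono (hsub.trans hsub1))
      (fun k z hz => hC k t ht z (mem_ball_zero_iff.mp (hsub hz)).le)
      (fun z hz => hh z (hsub1 (hsub hz)))).differentiableWithinAt
  have h0 : h 0 = 0 := by
    refine tendsto_nhds_unique (hh 0 (mem_ball_self one_pos)) ?_
    simp [rightQuotient, hv.map_zero ht (hle _)]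
  have hD : HasFDerivAt h (-ContinuousLinearMap.id ℂ E) 0 := by
    have hsub : ball (0 : E) (1 / 2) ⊆ ball 0 1 := ball_subset_ball (by norm_num)
    obtain ⟨C, hC⟩ := hv.exists_norm_rightQuotient_le (r := 1 / 2) (by norm_num)
    refine hasFDerivAt_of_tendsto_of_norm_le (R := 1 / 2) (by norm_num)
      (fun k => (hv.differentiableOn_rightQuotient k ht).mono hsub)
      (fun k z hz => hC k t ht z (mem_ball_zero_iff.mp hz).le)
      (fun z hz => hh z (hsub hz)) ?_
    have hfd : ∀ k : ℕ, fderiv ℂ (rightQuotient v k t) 0 =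
        ((((k : ℝ) + 1) * (Real.exp (-((k : ℝ) + 1)⁻¹) - 1) : ℝ) : ℂ) •
          ContinuousLinearMap.id ℂ E := by
      intro k
      have := (((hv.hasFDerivAt_zero t _ ht (hle k)).sub (hasFDerivAt_id 0)).const_smul
        ((k : ℂ) + 1)).fderiv
      refine Eq.trans ?_ (this.trans ?_)
      · rfl
      · rw [add_sub_cancel_left]
        push_cast
        module
    simp only [hfd]
    have := ((Complex.continuous_ofReal.tendsto _).comp tendsto_mul_exp_sub_one).smul_const
      (ContinuousLinearMap.id ℂ E)
    simpa [Function.comp_def] using this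
  refine ⟨hd, h0, hD, fun z hz hz0 l hl hl1 => re_neg_of_re_nonpos hd h0 hD ?_ hz hz0 l hl hl1⟩
  intro z hz hz0 l hl hl1
  have hlim : Tendsto (fun k => (l (rightQuotient v k t z)).re) atTop (𝓝 (l (h z)).re) :=
    (Complex.continuous_re.tendsto _).comp ((l.continuous.tendsto _).comp (hh z hz))
  refine le_of_tendsto hlim (Eventually.of_forall fun k => ?_)
  have h1 : (l (v t (t + ((k : ℝ) + 1)⁻¹) z)).re ≤ ‖z‖ := by
    refine (Complex.re_le_norm _).trans ((l.le_opNorm _).trans ?_)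
    rw [hl1, one_mul]
    exact hv.norm_le t _ ht (hle k) z hz
  have h2 : (l (rightQuotient v k t z)).re
      = (k + 1) * ((l (v t (t + ((k : ℝ) + 1)⁻¹) z)).re - ‖z‖) := by
    have : ((k : ℂ) + 1) = (((k : ℝ) + 1 : ℝ) : ℂ) := by push_cast; rfl
    rw [rightQuotient, map_smul, smul_eq_mul, this, Complex.re_ofReal_mul, map_sub, hl,
      Complex.sub_re, Complex.ofReal_re]
  rw [h2]
  exact mul_nonpos_of_nonneg_of_nonpos (by positivity) (by linarith)

/-- Rademacher's theorem on a countable dense set of points, extended to the whole ball by the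
equicontinuity of the difference quotients in `z`. -/
theorem ae_forall_differentiableAt [FiniteDimensional ℂ E] :
    ∀ᵐ t : ℝ, 0 < t → ∀ z ∈ ball (0 : E) 1, DifferentiableAt ℝ (fun s => v 0 s z) t := by
  have : CompleteSpace E := FiniteDimensional.complete ℂ E
  have : FiniteDimensional ℝ E := FiniteDimensional.complexToReal E
  have : ProperSpace E := FiniteDimensional.proper ℂ E
  have hae : ∀ᵐ t : ℝ, ∀ n : ℕ, TopologicalSpace.denseSeq E n ∈ ball (0 : E) 1 →
      DifferentiableAt ℝ (fun s => v 0 (max s 0) (TopologicalSpace.denseSeq E n)) t := by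
    rw [ae_all_iff]
    intro n
    by_cases hn : TopologicalSpace.denseSeq E n ∈ ball (0 : E) 1
    · obtain ⟨L, hL⟩ := hv.exists_lipschitzWith (mem_ball_zero_iff.mp hn)
      filter_upwards [(hL _ le_rfl).ae_differentiableAt_real] with t ht _ using ht
    · exact Eventually.of_forall fun t h => absurd h hn
  filter_upwards [hae] with t ht ht0 z hz
  have hmax : ∀ᶠ s : ℝ in 𝓝 t, max s 0 = s := by
    filter_upwards [lt_mem_nhds ht0] with s hs using max_eq_left hs.le
  set r := (1 + ‖z‖) / 2 with hr
  set R := (1 + r) / 2 with hR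
  have hz1 : ‖z‖ < 1 := mem_ball_zero_iff.mp hz
  have hzr : ‖z‖ < r := by rw [hr]; linarith
  have hr1 : r < 1 := by rw [hr]; linarith
  have hrR : r < R := by rw [hR]; linarith
  have hR1 : R < 1 := by rw [hR]; linarith
  have hsub : ball (0 : E) R ⊆ ball 0 1 := ball_subset_ball hR1.le
  obtain ⟨L, hL0, hL⟩ := hv.exists_lipschitz_right hR1
  set q : ℝ → E → E := fun s z => slope (fun s => v 0 s z) t s with hq
  have hqd : ∀ s, 0 < s → DifferentiableOn ℂ (q s) (ball 0 R) := by
    intro s hs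
    have : q s = fun z => ((s - t)⁻¹ : ℝ) • (v 0 s z - v 0 t z) := by
      ext z; simp [hq, slope_def_module]
    rw [this]
    exact (((hv.differentiableOn le_rfl hs.le).sub (hv.differentiableOn le_rfl ht0.le)).mono
      hsub).const_smul _
  have hqb : ∀ s, 0 < s → s ≠ t → ∀ z ∈ ball (0 : E) R, ‖q s z‖ ≤ L := by
    intro s hs hst z hz
    have hzR := (mem_ball_zero_iff.mp hz).le
    rw [hq]
    simp only [slope_def_module, norm_smul, norm_inv, Real.norm_eq_abs]
    rw [inv_mul_le_iff₀ (abs_pos.mpr (sub_ne_zero.mpr hst)), mul_comm]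
    rcases le_total s t with h | h
    · rw [abs_sub_comm, abs_of_nonneg (sub_nonneg.mpr h), norm_sub_rev]
      exact hL 0 s t le_rfl hs.le h z hzR
    · rw [abs_of_nonneg (sub_nonneg.mpr h)]
      exact hL 0 t s le_rfl ht0.le h z hzR
  set Λ := 2 * L / (R - r) with hΛ
  have hΛ0 : 0 ≤ Λ := div_nonneg (by positivity) (by linarith)
  obtain ⟨w, hw⟩ : ∃ w, Tendsto (fun s => q s z) (𝓝[≠] t) (𝓝 w) := by
    refine exists_tendsto_of_forall_approx fun ε hε => ?_
    -- a point of the dense sequence close to `z`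
    obtain ⟨n, hn⟩ := (TopologicalSpace.denseRange_denseSeq E).exists_mem_open
      (isOpen_ball (x := z) (ε := min (r - ‖z‖) (ε / (2 * (Λ + 1)))))
      ⟨z, mem_ball_self (lt_min (by linarith) (by positivity))⟩
    set y := TopologicalSpace.denseSeq E n with hy
    rw [Metric.mem_ball, lt_min_iff, dist_eq_norm] at hn
    have hyr : ‖y‖ ≤ r := by linarith [norm_le_norm_add_norm_sub z y, norm_sub_rev z y]
    have hyb : y ∈ ball (0 : E) 1 := mem_ball_zero_iff.mpr (hyr.trans_lt hr1)
    have hyd : DifferentiableAt ℝ (fun s => v 0 s y) t :=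
      (ht n hyb).congr_of_eventuallyEq (hmax.mono fun s hs => by simp only [hs, hy])
    have hys := hasDerivAt_iff_tendsto_slope.mp hyd.hasDerivAt
    refine ⟨deriv (fun s => v 0 s y) t, ?_⟩
    filter_upwards [hys.eventually (ball_mem_nhds _ (half_pos hε)),
      (lt_mem_nhds ht0).filter_mono nhdsWithin_le_nhds, self_mem_nhdsWithin] with s h1 h2 h3
    rw [dist_eq_norm] at h1
    have h4 := norm_sub_le_of_forall_norm_le (hqd s h2) (hqb s h2 h3) hrR hyr hzr.le
    rw [norm_sub_rev z y] at h4
    have h5 : Λ * ‖y - z‖ ≤ ε / 2 := by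
      have := hn.2.le
      rw [le_div_iff₀ (by positivity)] at this
      nlinarith [norm_nonneg (y - z)]
    calc ‖q s z - deriv (fun s => v 0 s y) t‖
        ≤ ‖q s z - q s y‖ + ‖q s y - deriv (fun s => v 0 s y) t‖ :=
          norm_sub_le_norm_sub_add_norm_sub _ _ _
      _ < ε / 2 + ε / 2 := add_lt_add_of_le_of_lt (h4.trans h5) h1
      _ = ε := add_halves ε
  exact (hasDerivAt_iff_tendsto_slope.mpr hw).differentiableAt

/-- At a time at which `v 0 s z` is differentiable in `s` the difference quotients of
`v t (t + τ) z` converge, because `v t (t + τ) = (v 0 t)⁻¹ ∘ v 0 (t + τ)` and `v 0 t` is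
biholomorphic. The limit satisfies the Loewner equation by the chain rule. -/
theorem exists_tendsto_rightQuotient [FiniteDimensional ℂ E] {t : ℝ} (ht : 0 < t) {z : E}
    (hz : z ∈ ball (0 : E) 1) (hd : DifferentiableAt ℝ (fun s => v 0 s z) t) :
    ∃ m, Tendsto (fun k => rightQuotient v k t z) atTop (𝓝 m) ∧
      HasDerivAt (fun s => v 0 s z) (fderiv ℂ (v 0 t) z m) t := by
  obtain ⟨-, hinv⟩ := isOpen_image_and_hasFDerivAt_invFunOn isOpen_ball
    (hv.contDiffOn 0 t le_rfl ht.le) (hv.injOn le_rfl ht.le)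
    (fun z hz => hv.injective_fderiv le_rfl ht.le hz)
  obtain ⟨e, he, hg⟩ := hinv z hz
  set w := deriv (fun s => v 0 s z) t
  have hw : HasDerivAt (fun s => v 0 s z) w t := hd.hasDerivAt
  refine ⟨e.symm w, ?_, ?_⟩
  · have h1 : HasDerivAt (fun s => Function.invFunOn (v 0 t) (ball 0 1) (v 0 s z))
        (e.symm w) t :=
      HasFDerivAt.comp_hasDerivAt (f := fun s => v 0 s z) t (hg.restrictScalars ℝ) hw
    have h2 : Tendsto (fun k : ℕ => t + ((k : ℝ) + 1)⁻¹) atTop (𝓝[≠] t) := by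
      refine tendsto_nhdsWithin_iff.mpr ⟨?_, Eventually.of_forall fun k => ?_⟩
      · simpa using tendsto_natCast_add_one_inv.const_add t
      · simp only [mem_compl_iff, mem_singleton_iff, add_eq_left, inv_eq_zero]
        positivity
    refine ((hasDerivAt_iff_tendsto_slope.mp h1).comp h2).congr fun k => ?_
    have hle : t ≤ t + ((k : ℝ) + 1)⁻¹ := le_add_of_nonneg_right (by positivity)
    have h3 : Function.invFunOn (v 0 t) (ball 0 1) (v 0 (t + ((k : ℝ) + 1)⁻¹) z)
        = v t (t + ((k : ℝ) + 1)⁻¹) z := by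
      rw [hv.comp 0 t _ le_rfl ht.le hle z hz]
      exact (hv.injOn le_rfl ht.le).leftInvOn_invFunOn (hv.mem_ball ht.le hle hz)
    have h4 : Function.invFunOn (v 0 t) (ball 0 1) (v 0 t z) = z :=
      (hv.injOn le_rfl ht.le).leftInvOn_invFunOn hz
    rw [Function.comp_apply, slope_def_module, h3, h4, add_sub_cancel_left, inv_inv, rightQuotient,
      ← Complex.coe_smul]
    push_cast
    rfl
  · rw [← he]
    simpa using hw

/-- The chain of an evolution family is a normalized decreasing Loewner chain and solves a Loewner
equation. The vector field is the limit of the difference quotients at the times at which it is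
known to exist, and the Herglotz function `-z` at the others. -/
theorem loewner [FiniteDimensional ℂ E] {f : ℝ → E → E}
    (hf : ∀ t, 0 ≤ t → ∀ z ∈ ball (0 : E) 1, f t z = v 0 t z) :
    IsNormalizedDecreasingLoewnerChain f ∧
      ∃ M : E → ℝ → E, IsHerglotzVectorField M ∧ SolvesLoewnerPDE f M := by
  have hfe : ∀ t, 0 ≤ t → ∀ z ∈ ball (0 : E) 1, f t =ᶠ[𝓝 z] v 0 t := fun t ht z hz => by
    filter_upwards [isOpen_ball.mem_nhds hz] with x hx using hf t ht x hx
  have hinit : ∀ z ∈ ball (0 : E) 1, f 0 z = z := fun z hz => by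
    rw [hf 0 le_rfl z hz, hv.refl 0 le_rfl z hz]
  refine ⟨⟨fun t ht => ?_, fun s t hs hst => ?_, hinit, fun t ht => ?_, fun t ht => ?_⟩, ?_⟩
  · refine isBiholomorphicOntoImage_of_injOn isOpen_ball
      ((hv.contDiffOn 0 t le_rfl ht).congr (hf t ht)) ?_ fun z hz => ?_
    · exact (hv.injOn le_rfl ht).congr fun z hz => (hf t ht z hz).symm
    · rw [(hfe t ht z hz).fderiv_eq]
      exact hv.injective_fderiv le_rfl ht hz
  · rintro _ ⟨z, hz, rfl⟩
    refine ⟨v s t z, hv.mem_ball hs hst hz, ?_⟩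
    rw [hf t (hs.trans hst) z hz, hf s hs _ (hv.mem_ball hs hst hz),
      hv.comp 0 s t le_rfl hs hst z hz]
  · rw [hf t ht 0 (mem_ball_self one_pos), hv.map_zero le_rfl ht]
  · have := hv.hasFDerivAt_zero 0 t le_rfl ht
    rw [sub_zero] at this
    exact this.congr_of_eventuallyEq (hfe t ht 0 (mem_ball_self one_pos))
  -- a measurable set of times of full measure at which all the time derivatives exist
  obtain ⟨N, hsub, hN, hN0⟩ := exists_measurable_superset_of_null
    (ae_iff.mp hv.ae_forall_differentiableAt)
  have hgood : ∀ t ∉ N, 0 < t → ∀ z ∈ ball (0 : E) 1,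
      DifferentiableAt ℝ (fun s => v 0 s z) t := fun t ht => by
    by_contra hcon
    exact ht (hsub hcon)
  have hgood' : ∀ t, 0 < t ∧ t ∉ N → ∀ z ∈ ball (0 : E) 1,
      ∃ m, Tendsto (fun k => rightQuotient v k t z) atTop (𝓝 m) ∧
        HasDerivAt (fun s => v 0 s z) (fderiv ℂ (v 0 t) z m) t := fun t ht z hz =>
    hv.exists_tendsto_rightQuotient ht.1 hz (hgood t ht.2 ht.1 z hz)
  classical
  set M : E → ℝ → E := fun z t =>
    if 0 < t ∧ t ∉ N then limUnder atTop (fun k => rightQuotient v k t z) else -z with hM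
  have hMlim : ∀ t, 0 < t ∧ t ∉ N → ∀ z ∈ ball (0 : E) 1,
      Tendsto (fun k => rightQuotient v k t z) atTop (𝓝 (M z t)) := fun t ht z hz => by
    obtain ⟨m, hm, -⟩ := hgood' t ht z hz
    simp only [hM, if_pos ht]
    exact tendsto_nhds_limUnder ⟨m, hm⟩
  refine ⟨M, ⟨fun t ht => ?_, fun z hz => ?_⟩, hinit, fun z hz T hT => ?_, ?_⟩
  · by_cases htN : 0 < t ∧ t ∉ N
    · exact hv.isHerglotzFunction_of_tendsto ht (hMlim t htN)
    · simp only [hM, if_neg htN]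
      exact isHerglotzFunction_neg
  · have hset : MeasurableSet {t : Ici (0 : ℝ) | 0 < (t : ℝ) ∧ (t : ℝ) ∉ N} :=
      measurable_subtype_coe (measurableSet_Ioi.inter hN.compl)
    refine stronglyMeasurable_of_tendsto atTop
      (f := fun (k : ℕ) (t : Ici (0 : ℝ)) =>
        if 0 < (t : ℝ) ∧ (t : ℝ) ∉ N then rightQuotient v k t z else -z) (fun k => ?_) ?_
    · refine StronglyMeasurable.ite hset ?_ stronglyMeasurable_const
      refine Continuous.stronglyMeasurable ?_
      exact ((hv.continuous_shift (by positivity) hz).sub continuous_const).const_smul _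
    · rw [tendsto_pi_nhds]
      intro t
      by_cases htN : 0 < (t : ℝ) ∧ (t : ℝ) ∉ N
      · simp only [if_pos htN]
        exact hMlim t htN z hz
      · simp only [hM, if_neg htN]
        exact tendsto_const_nhds
  · obtain ⟨L, hL⟩ := hv.exists_lipschitzWith (mem_ball_zero_iff.mp hz)
    refine LipschitzOnWith.absolutelyContinuousOnInterval (K := L) ?_
    have heq : ∀ t ∈ uIcc 0 T, f t z = v 0 (max t 0) z := fun t ht => by
      rw [uIcc_of_le hT] at ht
      rw [max_eq_left ht.1, hf t ht.1 z hz]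
    intro s hs t ht
    simp only [heq s hs, heq t ht]
    exact hL z le_rfl s t
  · rw [ae_restrict_iff' measurableSet_Ici]
    have h0 : ∀ᵐ t : ℝ, t ≠ 0 := by simp [ae_iff]
    have hNae : ∀ᵐ t : ℝ, t ∉ N := by simpa [ae_iff] using hN0
    filter_upwards [h0, hNae] with t ht0 htN ht z hz
    have htpos : 0 < t := lt_of_le_of_ne ht ht0.symm
    obtain ⟨m, hm, hder⟩ := hgood' t ⟨htpos, htN⟩ z hz
    rw [(hfe t ht z hz).fderiv_eq, tendsto_nhds_unique (hMlim t ⟨htpos, htN⟩ z hz) hm]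
    refine hder.congr_of_eventuallyEq ?_
    filter_upwards [lt_mem_nhds htpos] with s hs using hf s hs.le z hz

end IsEvolutionFamily
end EvolutionFamily

/-! ### Resolvent means of unitaries -/

section CStar

variable {A : Type*} [CStarAlgebra A]

theorem CStarAlgebra.norm_one_le : ‖(1 : A)‖ ≤ 1 := by
  rcases subsingleton_or_nontrivial A with h | h
  · simp [Subsingleton.elim (1 : A) 0]
  · exact CStarRing.norm_one.le

theorem CStarAlgebra.isUnit_one_sub {a : A} (ha : ‖a‖ < 1) : IsUnit (1 - a) :=
  ⟨Units.oneSub a ha, rfl⟩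

theorem CStarAlgebra.norm_inverse_one_sub_le {a : A} (ha : ‖a‖ < 1) :
    ‖Ring.inverse (1 - a)‖ ≤ (1 - ‖a‖)⁻¹ := by
  rw [NormedRing.inverse_one_sub a ha]
  refine (tsum_geometric_le_of_norm_lt_one a ha).trans ?_
  linarith [CStarAlgebra.norm_one_le (A := A)]

theorem CStarAlgebra.star_mul_self_le_of_norm_le [PartialOrder A] [StarOrderedRing A] {a : A}
    {r : ℝ} (h : ‖a‖ ≤ r) : star a * a ≤ algebraMap ℝ A (r ^ 2) := by
  have hr : 0 ≤ r := (norm_nonneg a).trans h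
  rw [← CStarAlgebra.norm_le_iff_le_algebraMap _ (by positivity) (star_mul_self_nonneg a),
    CStarRing.norm_star_mul_self, ← sq]
  gcongr

theorem CStarAlgebra.norm_le_of_star_mul_self_le [PartialOrder A] [StarOrderedRing A] {a : A}
    {r : ℝ} (hr : 0 ≤ r) (h : star a * a ≤ algebraMap ℝ A (r ^ 2)) : ‖a‖ ≤ r := by
  rw [← CStarAlgebra.norm_le_iff_le_algebraMap _ (by positivity) (star_mul_self_nonneg a),
    CStarRing.norm_star_mul_self, ← sq] at h
  exact (sq_le_sq₀ (norm_nonneg a) hr).mp h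

end CStar

namespace QuantumProbabilitySpace

variable {A B : Type*} [CStarAlgebra A] [CStarAlgebra B] [PartialOrder B] [StarOrderedRing B]
  (Q : QuantumProbabilitySpace A B)

theorem Φ_incl_mul (b : B) (a : A) : Q.Φ (Q.incl b * a) = b * Q.Φ a := by
  simpa using Q.Φ_bimodule b 1 a

theorem Φ_mul_incl (a : A) (b : B) : Q.Φ (a * Q.incl b) = Q.Φ a * b := by
  simpa using Q.Φ_bimodule 1 b a

theorem Φ_incl (b : B) : Q.Φ (Q.incl b) = b := by
  simpa [Q.Φ_one] using Q.Φ_incl_mul b 1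

theorem Φ_algebraMap (r : ℝ) : Q.Φ (algebraMap ℝ A r) = algebraMap ℝ B r := by
  have h1 : algebraMap ℝ A r = (r : ℂ) • 1 := by
    rw [Algebra.algebraMap_eq_smul_one, Complex.coe_smul]
  have h2 : algebraMap ℝ B r = (r : ℂ) • 1 := by
    rw [Algebra.algebraMap_eq_smul_one, Complex.coe_smul]
  rw [h1, h2, map_smul, Q.Φ_one]

theorem norm_incl_le (b : B) : ‖Q.incl b‖ ≤ ‖b‖ := NonUnitalStarAlgHom.norm_apply_le Q.incl b

/-- The inclusion as a continuous linear map. -/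
def inclL : B →L[ℂ] A :=
  (Q.incl : B →ₗ[ℂ] A).mkContinuous 1 fun b => by simpa using Q.norm_incl_le b

@[simp] theorem inclL_apply (b : B) : Q.inclL b = Q.incl b := rfl

theorem norm_mul_incl_le {V : A} (hV : V ∈ unitary A) (z : B) : ‖V * Q.incl z‖ ≤ ‖z‖ := by
  rw [CStarRing.norm_mem_unitary_mul _ hV]
  exact Q.norm_incl_le z

theorem isUnit_one_sub_mul_incl {V : A} (hV : V ∈ unitary A) {z : B} (hz : ‖z‖ < 1) :
    IsUnit (1 - V * Q.incl z) :=
  CStarAlgebra.isUnit_one_sub ((Q.norm_mul_incl_le hV z).trans_lt hz)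

/-- The resolvent mean `Φ((1 - V z)⁻¹) = 1 + ψ_V(z)`. -/
def resolventMean (V : A) (z : B) : B := Q.Φ (Ring.inverse (1 - V * Q.incl z))

/-- The `η`-transform `1 - Φ((1 - V z)⁻¹)⁻¹` of `V`. -/
def eta (V : A) (z : B) : B := 1 - Ring.inverse (Q.resolventMean V z)

theorem eta_one {z : B} (hz : ‖z‖ < 1) : Q.eta 1 z = z := by
  have h : Ring.inverse (1 - Q.incl z) = Q.incl (Ring.inverse (1 - z)) := by
    rw [← mul_one (Ring.inverse (1 - Q.incl z)), Ring.inverse_mul_eq_iff_eq_mul _ _ _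
      (CStarAlgebra.isUnit_one_sub ((Q.norm_incl_le z).trans_lt hz)), ← map_one Q.incl, ← map_sub,
      ← map_mul, Ring.mul_inverse_cancel _ (CStarAlgebra.isUnit_one_sub hz)]
  simp only [eta, resolventMean, one_mul, h, Q.Φ_incl]
  rw [Ring.inverse_inverse (CStarAlgebra.isUnit_one_sub hz)]
  abel

theorem inverse_resolventMean (V : A) (z : B) :
    Ring.inverse (Q.resolventMean V z) = 1 - Q.eta V z := by
  simp [eta]

variable [PartialOrder A] [StarOrderedRing A]

/-- A conditional expectation as a positive linear map. -/
def Φpos : A →ₚ[ℂ] B :=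
  PositiveLinearMap.mk₀ Q.Φ fun x hx => by
    obtain ⟨a, rfl⟩ := (CStarAlgebra.nonneg_iff_eq_star_mul_self).mp hx
    exact Q.Φ_nonneg a

theorem Φ_star (a : A) : Q.Φ (star a) = star (Q.Φ a) := map_star Q.Φpos a

theorem Φ_mono {a b : A} (h : a ≤ b) : Q.Φ a ≤ Q.Φ b := OrderHomClass.mono Q.Φpos h

/-- The Kadison–Schwarz inequality. -/
theorem star_Φ_mul_Φ_le (a : A) : star (Q.Φ a) * Q.Φ a ≤ Q.Φ (star a * a) := by
  have h := Q.Φ_nonneg (a - Q.incl (Q.Φ a))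
  have h1 : star (a - Q.incl (Q.Φ a)) * (a - Q.incl (Q.Φ a)) = star a * a
      - star a * Q.incl (Q.Φ a) - Q.incl (star (Q.Φ a)) * a
      + Q.incl (star (Q.Φ a) * Q.Φ a) := by
    rw [star_sub, ← map_star Q.incl, map_mul]
    noncomm_ring
  rw [h1, map_add, map_sub, map_sub, Q.Φ_mul_incl, Q.Φ_incl_mul, Q.Φ_incl, Q.Φ_star] at h
  rw [← sub_nonneg]
  convert h using 1
  noncomm_ring

theorem norm_Φ_le (a : A) : ‖Q.Φ a‖ ≤ ‖a‖ := by
  refine CStarAlgebra.norm_le_of_star_mul_self_le (norm_nonneg a) ?_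
  refine (Q.star_Φ_mul_Φ_le a).trans ?_
  rw [← Q.Φ_algebraMap]
  exact Q.Φ_mono (CStarAlgebra.star_mul_self_le_of_norm_le le_rfl)

/-- `Φ` as a continuous linear map. -/
def ΦL : A →L[ℂ] B := Q.Φ.mkContinuous 1 fun a => by simpa using Q.norm_Φ_le a

@[simp] theorem ΦL_apply (a : A) : Q.ΦL a = Q.Φ a := rfl

/-- The Cauchy–Schwarz inequality for the `B`-valued inner product `Φ(a⋆ b)`. -/
theorem norm_Φ_star_mul_sq_le {a b : A} {K : ℝ} (hK : 0 < K)
    (ha : Q.Φ (star a * a) ≤ algebraMap ℝ B K) :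
    ‖Q.Φ (star a * b)‖ ^ 2 ≤ K * ‖Q.Φ (star b * b)‖ := by
  obtain ⟨β, hab⟩ : ∃ β : B, Q.Φ (star a * b) = K • β :=
    ⟨K⁻¹ • Q.Φ (star a * b), (smul_inv_smul₀ hK.ne' _).symm⟩
  have hba : Q.Φ (star b * a) = K • star β := by
    have := Q.Φ_star (star a * b)
    rwa [star_mul, star_star, hab, star_smul, star_trivial K] at this
  have h := Q.Φ_nonneg (b - a * Q.incl β)
  have h1 : star (b - a * Q.incl β) * (b - a * Q.incl β) = star b * b
      - star b * a * Q.incl β - Q.incl (star β) * (star a * b)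
      + Q.incl (star β) * (star a * a * Q.incl β) := by
    rw [star_sub, star_mul, ← map_star Q.incl]
    noncomm_ring
  rw [h1, map_add, map_sub, map_sub, Q.Φ_mul_incl, Q.Φ_incl_mul, Q.Φ_incl_mul, Q.Φ_mul_incl,
    hab, hba] at h
  have h2 : star β * Q.Φ (star a * a) * β ≤ star β * algebraMap ℝ B K * β :=
    star_left_conjugate_le_conjugate ha β
  have h3 : star β * algebraMap ℝ B K * β = K • (star β * β) := by
    rw [Algebra.algebraMap_eq_smul_one, mul_smul_comm, mul_one, smul_mul_assoc]
  have h4 : K • (star β * β) ≤ Q.Φ (star b * b) := by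
    rw [← sub_nonneg]
    refine h.trans ?_
    rw [← mul_assoc, smul_mul_assoc, mul_smul_comm]
    rw [h3] at h2
    calc Q.Φ (star b * b) - K • (star β * β) - K • (star β * β) + star β * Q.Φ (star a * a) * β
        ≤ Q.Φ (star b * b) - K • (star β * β) - K • (star β * β) + K • (star β * β) := by gcongr
      _ = _ := by abel
  have h5 := CStarAlgebra.norm_le_norm_of_nonneg_of_le
    (smul_nonneg hK.le (star_mul_self_nonneg β)) h4
  rw [norm_smul, CStarRing.norm_star_mul_self, Real.norm_of_nonneg hK.le] at h5
  calc ‖Q.Φ (star a * b)‖ ^ 2 = K * (K * (‖β‖ * ‖β‖)) := by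
        rw [hab, norm_smul, Real.norm_of_nonneg hK.le]; ring
    _ ≤ K * ‖Q.Φ (star b * b)‖ := by gcongr

/-- If the unitary `V` has scalar mean `c` then `V - 1` is of order `(1 - c)^{1/2}` in the
`L²`-seminorm of `Φ`, so that `Φ((V - 1) x (V - 1))` is of order `1 - c`. -/
theorem norm_Φ_sub_one_mul_sub_one_le {V : A} (hV : V ∈ unitary A) {c κ : ℝ} (hκ : 0 < κ)
    (hcκ : 2 * (1 - c) ≤ κ) (hc : Q.Φ V = algebraMap ℝ B c) (x : A) :
    ‖Q.Φ ((V - 1) * x * (V - 1))‖ ≤ κ * ‖x‖ := by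
  have hstar : Q.Φ (star V) = algebraMap ℝ B c := by
    rw [Q.Φ_star, hc, Algebra.algebraMap_eq_smul_one, star_smul, star_one, star_trivial]
  have hle : algebraMap ℝ B (2 * (1 - c)) ≤ algebraMap ℝ B κ := by
    rw [Algebra.algebraMap_eq_smul_one, Algebra.algebraMap_eq_smul_one]
    exact smul_le_smul_of_nonneg_right hcκ zero_le_one
  have hΦ : (1 : B) - Q.Φ V - Q.Φ (star V) + 1 = algebraMap ℝ B (2 * (1 - c)) := by
    rw [hstar, hc, map_mul, map_sub, map_one, map_ofNat]
    noncomm_ring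
  have h1 : Q.Φ ((V - 1) * star (V - 1)) ≤ algebraMap ℝ B κ := by
    refine le_of_eq_of_le ?_ hle
    rw [← hΦ, star_sub, star_one, mul_sub, sub_mul, sub_mul, Unitary.mul_star_self_of_mem hV]
    simp only [one_mul, mul_one, map_sub, Q.Φ_one]
    abel
  have h2 : Q.Φ (star (V - 1) * (V - 1)) ≤ algebraMap ℝ B κ := by
    refine le_of_eq_of_le ?_ hle
    rw [← hΦ, star_sub, star_one, mul_sub, sub_mul, sub_mul, Unitary.star_mul_self_of_mem hV]
    simp only [one_mul, mul_one, map_sub, Q.Φ_one]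
    abel
  have h3 := Q.norm_Φ_star_mul_sq_le (a := star (V - 1)) (b := x * (V - 1)) hκ
    (by rwa [star_star])
  rw [star_star, ← mul_assoc] at h3
  have h4 : ‖Q.Φ (star (x * (V - 1)) * (x * (V - 1)))‖ ≤ ‖x‖ ^ 2 * κ := by
    rw [CStarAlgebra.norm_le_iff_le_algebraMap _ (by positivity) (Q.Φ_nonneg _)]
    have h5 : star (x * (V - 1)) * (x * (V - 1)) ≤ (‖x‖ ^ 2) • (star (V - 1) * (V - 1)) := by
      have := star_left_conjugate_le_conjugate
        (CStarAlgebra.star_mul_self_le_of_norm_le (le_refl ‖x‖)) (V - 1)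
      rw [Algebra.algebraMap_eq_smul_one, mul_smul_comm, mul_one, smul_mul_assoc] at this
      simpa [star_mul, mul_assoc] using this
    refine (Q.Φ_mono h5).trans ?_
    rw [← Complex.coe_smul, map_smul, Complex.coe_smul, map_mul (algebraMap ℝ B),
      ← Algebra.smul_def]
    exact smul_le_smul_of_nonneg_left h2 (by positivity)
  refine (sq_le_sq₀ (norm_nonneg _) (by positivity)).mp (h3.trans ?_)
  calc κ * ‖Q.Φ (star (x * (V - 1)) * (x * (V - 1)))‖ ≤ κ * (‖x‖ ^ 2 * κ) := by gcongr
    _ = (κ * ‖x‖) ^ 2 := by ring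

section Schwarz

variable {V : A} (hV : V ∈ unitary A) {z : B} (hz : ‖z‖ < 1)
include hV hz

/-- The positivity behind the Schwarz lemma: the inequality `(1 - r²) R⋆ R ≤ R + R⋆ - 1` for the
resolvent `R` of `V z`, carried over to its mean by the Kadison–Schwarz inequality. -/
theorem le_resolventMean {r : ℝ} (hr : ‖z‖ ≤ r) (hr1 : r ≤ 1) :
    (1 - r ^ 2) • (star (Q.resolventMean V z) * Q.resolventMean V z)
      ≤ Q.resolventMean V z + star (Q.resolventMean V z) - 1 := by
  set R := Ring.inverse (1 - V * Q.incl z) with hR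
  have hRV : (1 - V * Q.incl z) * R = 1 :=
    Ring.mul_inverse_cancel _ (Q.isUnit_one_sub_mul_incl hV hz)
  have h1 : R - 1 = V * (Q.incl z * R) := by
    rw [sub_mul, one_mul] at hRV
    rw [← hRV, mul_assoc]
    abel
  have h2 : star (R - 1) * (R - 1) = star R * (star (Q.incl z) * Q.incl z) * R := by
    rw [h1, star_mul, mul_assoc, ← mul_assoc (star V) V, Unitary.star_mul_self_of_mem hV, one_mul,
      star_mul]
    noncomm_ring
  have h3 : star (Q.incl z) * Q.incl z ≤ algebraMap ℝ A (r ^ 2) :=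
    CStarAlgebra.star_mul_self_le_of_norm_le ((Q.norm_incl_le z).trans hr)
  have h4 := star_left_conjugate_le_conjugate h3 R
  rw [← h2, Algebra.algebraMap_eq_smul_one, mul_smul_comm, mul_one, smul_mul_assoc, star_sub,
    star_one] at h4
  have h5 : (1 - r ^ 2) • (star R * R) ≤ R + star R - 1 := by
    rw [← sub_nonneg] at h4 ⊢
    refine h4.trans_eq ?_
    rw [sub_smul, one_smul]
    noncomm_ring
  have h6 := Q.Φ_mono h5
  rw [← Complex.coe_smul, map_smul, Complex.coe_smul, map_sub, map_add, Q.Φ_star, Q.Φ_one] at h6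
  refine le_trans ?_ h6
  exact smul_le_smul_of_nonneg_left (Q.star_Φ_mul_Φ_le R)
    (by nlinarith [norm_nonneg z])

/-- The mean of the resolvent is invertible: its real part is at least `1 / 2`, so that it has
trivial kernel, and `B` is finite-dimensional. -/
theorem isUnit_resolventMean [FiniteDimensional ℂ B] : IsUnit (Q.resolventMean V z) := by
  set P := Q.resolventMean V z with hP
  have h := Q.le_resolventMean hV hz hz.le le_rfl
  rw [one_pow, sub_self, zero_smul, ← hP] at h
  have hinj : ∀ x, P * x = 0 → x = 0 := by
    intro x hx
    have h1 := star_left_conjugate_le_conjugate h x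
    have h2 : star x * (P + star P - 1) * x = -(star x * x) := by
      have hx' : star x * star P = 0 := by rw [← star_mul, hx, star_zero]
      calc star x * (P + star P - 1) * x
          = star x * (P * x) + star x * star P * x - star x * x := by noncomm_ring
        _ = _ := by rw [hx, hx']; simp
    rw [h2, mul_zero, zero_mul, Left.nonneg_neg_iff] at h1
    exact CStarRing.star_mul_self_eq_zero_iff x |>.mp
      (le_antisymm h1 (star_mul_self_nonneg x))
  have hinj' : Function.Injective (LinearMap.mulLeft ℂ P) := by
    rw [injective_iff_map_eq_zero]
    exact hinj
  obtain ⟨y, hy⟩ := LinearMap.surjective_of_injective hinj' 1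
  rw [LinearMap.mulLeft_apply] at hy
  have hyP : y * P = 1 := by
    rw [← sub_eq_zero]
    refine hinj _ ?_
    rw [mul_sub, ← mul_assoc, hy, one_mul, mul_one, sub_self]
  exact ⟨⟨P, y, hy, hyP⟩, rfl⟩

/-- The Schwarz lemma for the `η`-transform of a unitary. -/
theorem norm_eta_le [FiniteDimensional ℂ B] : ‖Q.eta V z‖ ≤ ‖z‖ := by
  set P := Q.resolventMean V z with hP
  have hu : IsUnit P := Q.isUnit_resolventMean hV hz
  set y := Ring.inverse P with hy
  have hPy : P * y = 1 := Ring.mul_inverse_cancel _ hu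
  have h := Q.le_resolventMean hV hz le_rfl hz.le
  rw [← hP] at h
  have he : Q.eta V z = (P - 1) * y := by rw [sub_mul, hPy, one_mul]; rfl
  refine CStarAlgebra.norm_le_of_star_mul_self_le (norm_nonneg z) ?_
  have h1 : star (P - 1) * (P - 1) ≤ (‖z‖ ^ 2) • (star P * P) := by
    rw [← sub_nonneg] at h ⊢
    refine h.trans_eq ?_
    rw [sub_smul, one_smul, star_sub, star_one]
    noncomm_ring
  have h2 := star_left_conjugate_le_conjugate h1 y
  have h3 : star y * (‖z‖ ^ 2) • (star P * P) * y = algebraMap ℝ B (‖z‖ ^ 2) := by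
    have : star y * (star P * P) * y = 1 := by
      rw [← mul_assoc, ← star_mul, hPy, star_one, one_mul, hPy]
    rw [mul_smul_comm, smul_mul_assoc, this, Algebra.algebraMap_eq_smul_one]
  rw [h3] at h2
  rw [he, star_mul]
  refine le_of_eq_of_le ?_ h2
  noncomm_ring

end Schwarz

/-- The mean of the resolvent of `V` differs from the resolvent at `V = 1` by `O(1 - c)`: the first
order term is `Φ(V) - 1 = c - 1`, and the second order term is bounded by the Cauchy–Schwarz
inequality. -/
theorem norm_resolventMean_sub_le {V : A} (hV : V ∈ unitary A) {c κ : ℝ} (hκ : 0 < κ) (hc1 : c ≤ 1)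
    (hcκ : 2 * (1 - c) ≤ κ) (hc : Q.Φ V = algebraMap ℝ B c) {z : B} {r : ℝ} (hzr : ‖z‖ ≤ r)
    (hr : r < 1) :
    ‖Q.resolventMean V z - Ring.inverse (1 - z)‖ ≤ ((1 - r)⁻¹ ^ 2 + (1 - r)⁻¹ ^ 3) * κ := by
  have hz : ‖z‖ < 1 := hzr.trans_lt hr
  have hr0 : 0 ≤ r := (norm_nonneg z).trans hzr
  have hr' : 0 < 1 - r := by linarith
  set p := Ring.inverse (1 - z) with hp
  have hp1 : (1 - z) * p = 1 := Ring.mul_inverse_cancel _ (CStarAlgebra.isUnit_one_sub hz)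
  have hp2 : p * (1 - z) = 1 := Ring.inverse_mul_cancel _ (CStarAlgebra.isUnit_one_sub hz)
  set R := Ring.inverse (1 - V * Q.incl z) with hR
  have hu := Q.isUnit_one_sub_mul_incl hV hz
  have hR1 : (1 - V * Q.incl z) * R = 1 := Ring.mul_inverse_cancel _ hu
  have hR2 : R * (1 - V * Q.incl z) = 1 := Ring.inverse_mul_cancel _ hu
  have hP1 : (1 - Q.incl z) * Q.incl p = 1 := by rw [← map_one Q.incl, ← map_sub, ← map_mul, hp1]
  have hP2 : Q.incl p * (1 - Q.incl z) = 1 := by rw [← map_one Q.incl, ← map_sub, ← map_mul, hp2]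
  have hpn : ‖p‖ ≤ (1 - r)⁻¹ := (CStarAlgebra.norm_inverse_one_sub_le hz).trans (by gcongr)
  have hRn : ‖R‖ ≤ (1 - r)⁻¹ :=
    (CStarAlgebra.norm_inverse_one_sub_le ((Q.norm_mul_incl_le hV z).trans_lt hz)).trans
      (inv_anti₀ hr' (by linarith [Q.norm_mul_incl_le hV z]))
  -- second order expansion of the resolvent around `V = 1`
  have e1 : R = Q.incl p + R * ((V - 1) * Q.incl z) * Q.incl p := by
    calc R = R * ((1 - Q.incl z) * Q.incl p) := by rw [hP1, mul_one]
      _ = (R * (1 - V * Q.incl z)) * Q.incl p + R * ((V - 1) * Q.incl z) * Q.incl p := by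
        noncomm_ring
      _ = _ := by rw [hR2, one_mul]
  have e2 : R = Q.incl p + Q.incl p * ((V - 1) * Q.incl z) * R := by
    calc R = (Q.incl p * (1 - Q.incl z)) * R := by rw [hP2, one_mul]
      _ = Q.incl p * ((1 - V * Q.incl z) * R) + Q.incl p * ((V - 1) * Q.incl z) * R := by
        noncomm_ring
      _ = _ := by rw [hR1, mul_one]
  have e3 : R = Q.incl p + Q.incl p * ((V - 1) * Q.incl (z * p)) +
      Q.incl p * (((V - 1) * (Q.incl z * R) * (V - 1)) * Q.incl (z * p)) := by
    nth_rewrite 1 [e2]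
    nth_rewrite 1 [e1]
    rw [map_mul]
    noncomm_ring
  have e4 : Q.resolventMean V z - p = p * ((Q.Φ V - 1) * (z * p)) +
      p * (Q.Φ ((V - 1) * (Q.incl z * R) * (V - 1)) * (z * p)) := by
    rw [resolventMean, ← hR]
    nth_rewrite 1 [e3]
    rw [map_add, map_add, Q.Φ_incl, Q.Φ_incl_mul, Q.Φ_mul_incl, Q.Φ_incl_mul, Q.Φ_mul_incl,
      map_sub, Q.Φ_one]
    abel
  have hV1 : ‖Q.Φ V - 1‖ ≤ κ := by
    rw [hc, ← map_one (algebraMap ℝ B), ← map_sub]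
    refine (norm_algebraMap B _).trans_le ?_
    have : ‖c - 1‖ ≤ κ := by rw [Real.norm_eq_abs, abs_sub_comm, abs_of_nonneg] <;> linarith
    calc ‖c - 1‖ * ‖(1 : B)‖ ≤ κ * 1 := by gcongr; exact CStarAlgebra.norm_one_le
      _ = κ := mul_one κ
  have hV2 : ‖Q.Φ ((V - 1) * (Q.incl z * R) * (V - 1))‖ ≤ κ * (1 - r)⁻¹ := by
    refine (Q.norm_Φ_sub_one_mul_sub_one_le hV hκ hcκ hc _).trans ?_
    gcongr
    calc ‖Q.incl z * R‖ ≤ ‖Q.incl z‖ * ‖R‖ := norm_mul_le _ _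
      _ ≤ 1 * (1 - r)⁻¹ := by gcongr; exact (Q.norm_incl_le z).trans hz.le
      _ = _ := one_mul _
  have hzp : ‖z * p‖ ≤ (1 - r)⁻¹ := by
    calc ‖z * p‖ ≤ ‖z‖ * ‖p‖ := norm_mul_le _ _
      _ ≤ 1 * (1 - r)⁻¹ := by gcongr
      _ = _ := one_mul _
  have hmul : ∀ (x : B) (k : ℝ), ‖x‖ ≤ k → ‖p * (x * (z * p))‖ ≤ (1 - r)⁻¹ * (k * (1 - r)⁻¹) := by
    intro x k hx
    have hk : 0 ≤ k := (norm_nonneg x).trans hx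
    calc ‖p * (x * (z * p))‖ ≤ ‖p‖ * (‖x‖ * ‖z * p‖) :=
          (norm_mul_le _ _).trans (by gcongr; exact norm_mul_le _ _)
      _ ≤ _ := by gcongr
  rw [e4]
  refine (norm_add_le _ _).trans ((add_le_add (hmul _ _ hV1) (hmul _ _ hV2)).trans_eq ?_)
  ring

theorem norm_eta_sub_le [FiniteDimensional ℂ B] {V : A} (hV : V ∈ unitary A) {c κ : ℝ} (hκ : 0 < κ)
    (hc1 : c ≤ 1) (hcκ : 2 * (1 - c) ≤ κ) (hc : Q.Φ V = algebraMap ℝ B c) {z : B} {r : ℝ}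
    (hzr : ‖z‖ ≤ r) (hr : r < 1) :
    ‖Q.eta V z - z‖ ≤ 4 * (((1 - r)⁻¹ ^ 2 + (1 - r)⁻¹ ^ 3) * κ) := by
  have hz : ‖z‖ < 1 := hzr.trans_lt hr
  set p := Ring.inverse (1 - z) with hp
  have hp2 : p * (1 - z) = 1 := Ring.inverse_mul_cancel _ (CStarAlgebra.isUnit_one_sub hz)
  have hP := Ring.inverse_mul_cancel _ (Q.isUnit_resolventMean hV hz)
  rw [inverse_resolventMean] at hP
  have h1 : Q.eta V z - z = (1 - Q.eta V z) * ((Q.resolventMean V z - p) * (1 - z)) := by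
    calc Q.eta V z - z = 1 * (1 - z) - (1 - Q.eta V z) * 1 := by noncomm_ring
      _ = _ := by
        nth_rewrite 1 [← hP]
        nth_rewrite 4 [← hp2]
        noncomm_ring
  have h2 : ‖1 - Q.eta V z‖ ≤ 2 := by
    linarith [norm_sub_le 1 (Q.eta V z), Q.norm_eta_le hV hz, CStarAlgebra.norm_one_le (A := B)]
  have h3 : ‖1 - z‖ ≤ 2 := by
    linarith [norm_sub_le 1 z, CStarAlgebra.norm_one_le (A := B)]
  have h4 := Q.norm_resolventMean_sub_le hV hκ hc1 hcκ hc hzr hr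
  rw [h1]
  calc ‖(1 - Q.eta V z) * ((Q.resolventMean V z - p) * (1 - z))‖
      ≤ ‖1 - Q.eta V z‖ * (‖Q.resolventMean V z - p‖ * ‖1 - z‖) :=
        (norm_mul_le _ _).trans (by gcongr; exact norm_mul_le _ _)
    _ ≤ 2 * (((1 - r)⁻¹ ^ 2 + (1 - r)⁻¹ ^ 3) * κ * 2) := by gcongr
    _ = _ := by ring

theorem contDiffOn_eta [FiniteDimensional ℂ B] {V : A} (hV : V ∈ unitary A) :
    ContDiffOn ℂ 1 (Q.eta V) (ball 0 1) := by
  intro z hz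
  rw [mem_ball_zero_iff] at hz
  refine ContDiffAt.contDiffWithinAt ?_
  have hu := Q.isUnit_one_sub_mul_incl hV hz
  have hP := Q.isUnit_resolventMean hV hz
  have h1 : ContDiffAt ℂ 1 (fun z : B => 1 - V * Q.inclL z) z := by fun_prop
  have h2 : ContDiffAt ℂ 1 (Ring.inverse : A → A) (1 - V * Q.inclL z) :=
    contDiffAt_ringInverse ℂ hu.unit
  have h3' : ContDiffAt ℂ 1 (Q.ΦL ∘ Ring.inverse ∘ fun z : B => 1 - V * Q.inclL z) z :=
    Q.ΦL.contDiff.contDiffAt.comp z (h2.comp z h1)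
  have h3 : ContDiffAt ℂ 1 (Q.resolventMean V) z := h3'
  have h4 : ContDiffAt ℂ 1 (Ring.inverse : B → B) (Q.resolventMean V z) :=
    contDiffAt_ringInverse ℂ hP.unit
  exact contDiffAt_const.sub (h4.comp z h3)

theorem hasFDerivAt_eta_zero {V : A} {c : ℝ} (hc : Q.Φ V = algebraMap ℝ B c) :
    HasFDerivAt (Q.eta V) ((c : ℂ) • ContinuousLinearMap.id ℂ B) 0 := by
  have h1 : HasFDerivAt (fun z : B => 1 - V * Q.inclL z)
      (-(ContinuousLinearMap.mul ℂ A V).comp Q.inclL) 0 :=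
    (((ContinuousLinearMap.mul ℂ A V).comp Q.inclL).hasFDerivAt).const_sub 1
  have h2 : HasFDerivAt (Ring.inverse : A → A)
      (-ContinuousLinearMap.mulLeftRight ℂ A 1 1) ((fun z : B => 1 - V * Q.inclL z) 0) := by
    have := hasFDerivAt_ringInverse (𝕜 := ℂ) (1 : Aˣ)
    simpa using this
  have h3 := (Q.ΦL.hasFDerivAt).comp (0 : B) (h2.comp (0 : B) h1)
  have hP0 : Q.resolventMean V 0 = 1 := by simp [resolventMean, Q.Φ_one]
  have h4 : HasFDerivAt (Ring.inverse : B → B)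
      (-ContinuousLinearMap.mulLeftRight ℂ B 1 1) (Q.resolventMean V 0) := by
    have := hasFDerivAt_ringInverse (𝕜 := ℂ) (1 : Bˣ)
    simpa [hP0] using this
  have h5 := (h4.comp (f := Q.resolventMean V) (0 : B) h3).const_sub 1
  refine h5.congr_fderiv ?_
  ext w
  simp [Q.Φ_mul_incl, hc, Algebra.algebraMap_eq_smul_one]

/-- The `η`-transforms of a family of unitaries which satisfy the subordination identity form an
evolution family. -/
theorem isEvolutionFamily_eta [FiniteDimensional ℂ B] {V : ℝ → ℝ → A}
    (hV : ∀ s t, 0 ≤ s → s ≤ t → V s t ∈ unitary A) (hV1 : ∀ s, 0 ≤ s → V s s = 1)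
    (hmean : ∀ s t, 0 ≤ s → s ≤ t → Q.Φ (V s t) = algebraMap ℝ B (Real.exp (-(t - s))))
    (hsub : ∀ r s t, 0 ≤ r → r ≤ s → s ≤ t → ∀ z : B, ‖z‖ < 1 →
      Q.resolventMean (V r t) z = Q.resolventMean (V r s) (Q.eta (V s t) z)) :
    IsEvolutionFamily fun s t => Q.eta (V s t) where
  contDiffOn s t hs hst := Q.contDiffOn_eta (hV s t hs hst)
  norm_le s t hs hst z hz := Q.norm_eta_le (hV s t hs hst) (mem_ball_zero_iff.mp hz)
  hasFDerivAt_zero s t hs hst := Q.hasFDerivAt_eta_zero (hmean s t hs hst)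
  refl s hs z hz := by
    simp only [hV1 s hs, Q.eta_one (mem_ball_zero_iff.mp hz)]
  comp r s t hr hrs hst z hz := by
    simp only [eta]
    rw [hsub r s t hr hrs hst z (mem_ball_zero_iff.mp hz)]
    rfl
  norm_sub_le r hr := by
    refine ⟨4 * ((1 - r)⁻¹ ^ 2 + (1 - r)⁻¹ ^ 3) * 2, fun s t hs hst z hz => ?_⟩
    rcases hst.eq_or_lt with rfl | hlt
    · simp [hV1 s hs, Q.eta_one (hz.trans_lt hr)]
    have h1 : Real.exp (-(t - s)) ≤ 1 := Real.exp_le_one_iff.mpr (by linarith)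
    have h2 := Real.add_one_le_exp (-(t - s))
    refine (Q.norm_eta_sub_le (hV s t hs hst) (κ := 2 * (t - s)) (by linarith) h1 (by linarith)
      (hmean s t hs hst) hz hr).trans_eq ?_
    ring

end QuantumProbabilitySpace

/-! ### Monotone independence and subordination -/

namespace QuantumProbabilitySpace

section Words

variable {A B : Type*} [CStarAlgebra A] [CStarAlgebra B] [PartialOrder B] [StarOrderedRing B]
  (Q : QuantumProbabilitySpace A B)

/-- Monotone independence for words given as lists of letters. -/
theorem MonotoneIndependent.Φ_prod_mul_mul_prod {I : Type*} [LinearOrder I]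
    {S : I → NonUnitalSubalgebra ℂ A} (h : Q.MonotoneIndependent S) {L L' : List (I × A)}
    (hL : ∀ q ∈ L, q.2 ∈ S q.1) (hL' : ∀ q ∈ L', q.2 ∈ S q.1) {i : I} {x : A} (hx : x ∈ S i)
    (hlast : ∀ k (hk : k < L.length), k + 1 = L.length → L[k].1 < i)
    (hhead : ∀ hk : 0 < L'.length, L'[0].1 < i) :
    Q.Φ ((L.map Prod.snd).prod * x * (L'.map Prod.snd).prod) =
      Q.Φ ((L.map Prod.snd).prod * Q.incl (Q.Φ x) * (L'.map Prod.snd).prod) := by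
  set l : List (I × A) := L ++ (i, x) :: L' with hl
  have hlen : L.length < l.length := by simp [hl]
  have hp : l[L.length] = (i, x) := by simp [hl]
  have h1 := h l.length (fun k => l[k].1) (fun k => l[k].2) (fun k => by
    have : l[k] ∈ l := List.getElem_mem _
    generalize l[k] = q at this
    simp only [hl, List.mem_append, List.mem_cons] at this
    rcases this with h | h | h
    · exact hL _ h
    · rw [h]; exact hx
    · exact hL' _ h) ⟨L.length, hlen⟩
    (fun q hq => by
      have hq' : (q : ℕ) < L.length := by simp only at hq; omega
      have : l[q] = L[(q : ℕ)] := by simp [hl, hq']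
      simp only [this, Fin.getElem_fin, hp]
      exact hlast q hq' hq)
    (fun q hq => by
      have hq2 : (q : ℕ) = L.length + 1 := hq
      have hpos : 0 < L'.length := by
        have := q.2
        simp only [hl, List.length_append, List.length_cons] at this
        omega
      have : l[q] = L'[0] := by simp [hl, hq2, List.getElem_append_right]
      simp only [this, Fin.getElem_fin, hp]
      exact hhead hpos)
  have h2 : List.ofFn (fun k : Fin l.length => l[k].2) = l.map Prod.snd :=
    List.ext_getElem (by simp) (by simp)
  have h3 : List.ofFn (Function.update (fun k : Fin l.length => l[k].2) ⟨L.length, hlen⟩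
      (Q.incl (Q.Φ l[L.length].2))) = (l.map Prod.snd).set L.length (Q.incl (Q.Φ x)) := by
    refine List.ext_getElem (by simp) fun k hk hk' => ?_
    rw [List.getElem_set]
    by_cases hkL : L.length = k
    · subst hkL
      simp [hp]
    · rw [if_neg hkL]
      have : (⟨k, by simpa using hk⟩ : Fin l.length) ≠ ⟨L.length, hlen⟩ := by
        simpa [Fin.ext_iff] using fun h => hkL h.symm
      simp [Function.update_of_ne this]
  have h4 : (l.map Prod.snd).set L.length (Q.incl (Q.Φ x)) =
      L.map Prod.snd ++ Q.incl (Q.Φ x) :: L'.map Prod.snd := by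
    simp [hl]
  simp only [Fin.getElem_fin] at h1 h2 h3
  rw [h2, h3, h4] at h1
  simpa [hl, mul_assoc] using h1

theorem incl_mul_mem_generatedSubalgebra {x y : A} (b : B) (hy : y ∈ Q.generatedSubalgebra x) :
    Q.incl b * y ∈ Q.generatedSubalgebra x := by
  induction hy using NonUnitalAlgebra.adjoin_induction with
  | mem y hy =>
    obtain ⟨b₁, b₂, rfl⟩ := hy
    refine NonUnitalAlgebra.subset_adjoin ℂ ⟨b * b₁, b₂, ?_⟩
    rw [map_mul]
    noncomm_ring
  | add y z _ _ hy hz => rw [mul_add]; exact add_mem hy hz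
  | zero => rw [mul_zero]; exact zero_mem _
  | mul y z _ hz hy _ => rw [← mul_assoc]; exact mul_mem hy hz
  | smul c y _ hy => rw [mul_smul_comm]; exact SMulMemClass.smul_mem c hy

theorem mul_incl_mem_generatedSubalgebra {x y : A} (b : B) (hy : y ∈ Q.generatedSubalgebra x) :
    y * Q.incl b ∈ Q.generatedSubalgebra x := by
  induction hy using NonUnitalAlgebra.adjoin_induction with
  | mem y hy =>
    obtain ⟨b₁, b₂, rfl⟩ := hy
    refine NonUnitalAlgebra.subset_adjoin ℂ ⟨b₁, b₂ * b, ?_⟩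
    rw [map_mul]
    noncomm_ring
  | add y z _ _ hy hz => rw [add_mul]; exact add_mem hy hz
  | zero => rw [zero_mul]; exact zero_mem _
  | mul y z hy _ _ hz => rw [mul_assoc]; exact mul_mem hy hz
  | smul c y _ hy => rw [smul_mul_assoc]; exact SMulMemClass.smul_mem c hy

theorem self_mem_generatedSubalgebra (x : A) : x ∈ Q.generatedSubalgebra x :=
  NonUnitalAlgebra.subset_adjoin ℂ ⟨1, 1, by simp⟩

/-- The algebra generated by `B` and `v` is `B + B⟨v⟩₀`. -/
theorem exists_eq_incl_add_of_mem_adjoin {v x : A}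
    (hx : x ∈ Algebra.adjoin ℂ (insert v (range Q.incl))) :
    ∃ b : B, ∃ y ∈ Q.generatedSubalgebra v, x = Q.incl b + y := by
  induction hx using Algebra.adjoin_induction with
  | mem x hx =>
    rcases hx with rfl | ⟨b, rfl⟩
    · exact ⟨0, x, Q.self_mem_generatedSubalgebra x, by simp⟩
    · exact ⟨b, 0, zero_mem _, by simp⟩
  | algebraMap r => exact ⟨algebraMap ℂ B r, 0, zero_mem _, by simp [AlgHomClass.commutes]⟩
  | add x₁ x₂ _ _ h₁ h₂ =>
    obtain ⟨b₁, y₁, hy₁, rfl⟩ := h₁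
    obtain ⟨b₂, y₂, hy₂, rfl⟩ := h₂
    exact ⟨b₁ + b₂, y₁ + y₂, add_mem hy₁ hy₂, by rw [map_add]; abel⟩
  | mul x₁ x₂ _ _ h₁ h₂ =>
    obtain ⟨b₁, y₁, hy₁, rfl⟩ := h₁
    obtain ⟨b₂, y₂, hy₂, rfl⟩ := h₂
    refine ⟨b₁ * b₂, Q.incl b₁ * y₂ + y₁ * Q.incl b₂ + y₁ * y₂, add_mem (add_mem
      (Q.incl_mul_mem_generatedSubalgebra b₁ hy₂) (Q.mul_incl_mem_generatedSubalgebra b₂ hy₁))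
      (mul_mem hy₁ hy₂), ?_⟩
    rw [map_mul]
    noncomm_ring

/-- Products of letters from the algebras generated by the `w i` in which the last letter belongs to
the algebra number `i`. -/
def wordsEndingIn {I : Type*} (w : I → A) (i : I) : Set A :=
  {a | ∃ (L : List (I × A)) (y : A), (∀ q ∈ L, q.2 ∈ Q.generatedSubalgebra (w q.1)) ∧
    y ∈ Q.generatedSubalgebra (w i) ∧ a = (L.map Prod.snd).prod * y}

/-- Products of letters from the algebras generated by the `w i` in which the first letter belongs
to the algebra number `i`. -/
def wordsStartingIn {I : Type*} (w : I → A) (i : I) : Set A :=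
  {a | ∃ (L : List (I × A)) (y : A), (∀ q ∈ L, q.2 ∈ Q.generatedSubalgebra (w q.1)) ∧
    y ∈ Q.generatedSubalgebra (w i) ∧ a = y * (L.map Prod.snd).prod}

theorem mul_mem_span_wordsEndingIn {I : Type*} {w : I → A} {i : I} {x a : A}
    (hx : x ∈ Algebra.adjoin ℂ (range w ∪ range Q.incl))
    (ha : a ∈ Submodule.span ℂ (Q.wordsEndingIn w i)) :
    x * a ∈ Submodule.span ℂ (Q.wordsEndingIn w i) := by
  induction hx using Algebra.adjoin_induction generalizing a with
  | mem x hx =>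
    induction ha using Submodule.span_induction with
    | mem a ha =>
      obtain ⟨L, y, hL, hy, rfl⟩ := ha
      refine Submodule.subset_span ?_
      rcases hx with ⟨k, rfl⟩ | ⟨b, rfl⟩
      · refine ⟨(k, w k) :: L, y, ?_, hy, by simp [mul_assoc]⟩
        simpa [Q.self_mem_generatedSubalgebra] using hL
      · cases L with
        | nil => exact ⟨[], Q.incl b * y, by simp, Q.incl_mul_mem_generatedSubalgebra b hy, by simp⟩
        | cons q L =>
          refine ⟨(q.1, Q.incl b * q.2) :: L, y, ?_, hy, by simp [mul_assoc]⟩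
          simp only [List.mem_cons, forall_eq_or_imp] at hL ⊢
          exact ⟨Q.incl_mul_mem_generatedSubalgebra b hL.1, hL.2⟩
    | zero => rw [mul_zero]; exact zero_mem _
    | add a c _ _ ha hc => rw [mul_add]; exact add_mem ha hc
    | smul r a _ ha => rw [mul_smul_comm]; exact Submodule.smul_mem _ r ha
  | algebraMap r => rw [← Algebra.smul_def]; exact Submodule.smul_mem _ r ha
  | add x y _ _ hx hy => rw [add_mul]; exact add_mem (hx ha) (hy ha)
  | mul x y _ _ hx hy => rw [mul_assoc]; exact hx (hy ha)

theorem mul_mem_span_wordsStartingIn {I : Type*} {w : I → A} {i : I} {x a : A}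
    (hx : x ∈ Algebra.adjoin ℂ (range w ∪ range Q.incl))
    (ha : a ∈ Submodule.span ℂ (Q.wordsStartingIn w i)) :
    a * x ∈ Submodule.span ℂ (Q.wordsStartingIn w i) := by
  induction hx using Algebra.adjoin_induction generalizing a with
  | mem x hx =>
    induction ha using Submodule.span_induction with
    | mem a ha =>
      obtain ⟨L, y, hL, hy, rfl⟩ := ha
      refine Submodule.subset_span ?_
      rcases hx with ⟨k, rfl⟩ | ⟨b, rfl⟩
      · refine ⟨L ++ [(k, w k)], y, ?_, hy, by simp [mul_assoc]⟩
        intro q hq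
        rcases List.mem_append.mp hq with hq | hq
        · exact hL q hq
        · rw [List.mem_singleton.mp hq]; exact Q.self_mem_generatedSubalgebra _
      · rcases List.eq_nil_or_concat L with rfl | ⟨L, q, rfl⟩
        · exact ⟨[], y * Q.incl b, by simp, Q.mul_incl_mem_generatedSubalgebra b hy, by simp⟩
        · refine ⟨L ++ [(q.1, q.2 * Q.incl b)], y, ?_, hy, by simp [mul_assoc]⟩
          intro q' hq
          rcases List.mem_append.mp hq with hq | hq
          · exact hL q' (by simp [hq])
          · rw [List.mem_singleton.mp hq]
            exact Q.mul_incl_mem_generatedSubalgebra b (hL q (by simp))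
    | zero => rw [zero_mul]; exact zero_mem _
    | add a c _ _ ha hc => rw [add_mul]; exact add_mem ha hc
    | smul r a _ ha => rw [smul_mul_assoc]; exact Submodule.smul_mem _ r ha
  | algebraMap r =>
    rw [← Algebra.commutes, ← Algebra.smul_def]; exact Submodule.smul_mem _ r ha
  | add x y _ _ hx hy => rw [mul_add]; exact add_mem (hx ha) (hy ha)
  | mul x y _ _ hx hy => rw [← mul_assoc]; exact hy (hx ha)

/-- The closed span of `1` and the words that end in the algebra number `i`: elements which may
stand to the left of a letter of index greater than `i`. -/
def leftModule {I : Type*} (w : I → A) (i : I) : Submodule ℂ A :=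
  (Submodule.span ℂ (insert 1 (Q.wordsEndingIn w i))).topologicalClosure

/-- The closed span of `1` and the words that start in the algebra number `i`: elements which may
stand to the right of a letter of index greater than `i`. -/
def rightModule {I : Type*} (w : I → A) (i : I) : Submodule ℂ A :=
  (Submodule.span ℂ (insert 1 (Q.wordsStartingIn w i))).topologicalClosure

/-- The closed algebra generated by `B` and the `w i`. -/
def closedAlgebra {I : Type*} (w : I → A) : Subalgebra ℂ A :=
  (Algebra.adjoin ℂ (range w ∪ range Q.incl)).topologicalClosure

theorem one_mem_leftModule {I : Type*} (w : I → A) (i : I) : 1 ∈ Q.leftModule w i :=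
  Submodule.le_topologicalClosure _ (Submodule.subset_span (mem_insert _ _))

theorem one_mem_rightModule {I : Type*} (w : I → A) (i : I) : 1 ∈ Q.rightModule w i :=
  Submodule.le_topologicalClosure _ (Submodule.subset_span (mem_insert _ _))

theorem mul_mem_leftModule {I : Type*} {w : I → A} (i : I) {x : A} (hx : x ∈ Q.closedAlgebra w) :
    x * w i ∈ Q.leftModule w i := by
  refine map_mem_closure (f := fun y => y * w i) (by fun_prop) hx fun y hy => ?_
  refine Submodule.span_mono (subset_insert _ _) (Q.mul_mem_span_wordsEndingIn hy ?_)
  exact Submodule.subset_span ⟨[], w i, by simp, Q.self_mem_generatedSubalgebra _, by simp⟩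

theorem mul_mem_rightModule {I : Type*} {w : I → A} (i : I) {x : A} (hx : x ∈ Q.closedAlgebra w) :
    w i * x ∈ Q.rightModule w i := by
  refine map_mem_closure (f := fun y => w i * y) (by fun_prop) hx fun y hy => ?_
  refine Submodule.span_mono (subset_insert _ _) (Q.mul_mem_span_wordsStartingIn hy ?_)
  exact Submodule.subset_span ⟨[], w i, by simp, Q.self_mem_generatedSubalgebra _, by simp⟩

variable [PartialOrder A] [StarOrderedRing A]

/-- Monotone independence for a letter from the closed unital algebra of index `k > i` between
elements of the closed modules of index `i`. -/
theorem MonotoneIndependent.Φ_mul_mul {I : Type*} [LinearOrder I] {w : I → A}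
    (h : Q.MonotoneIndependent fun i => Q.generatedSubalgebra (w i)) {i k : I} (hik : i < k)
    {a x c : A} (ha : a ∈ Q.leftModule w i)
    (hx : x ∈ (Algebra.adjoin ℂ (insert (w k) (range Q.incl))).topologicalClosure)
    (hc : c ∈ Q.rightModule w i) : Q.Φ (a * x * c) = Q.Φ (a * Q.incl (Q.Φ x) * c) := by
  have key : ∀ a ∈ Submodule.span ℂ (insert 1 (Q.wordsEndingIn w i)),
      ∀ x ∈ Algebra.adjoin ℂ (insert (w k) (range Q.incl)),
      ∀ c ∈ Submodule.span ℂ (insert 1 (Q.wordsStartingIn w i)),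
      Q.Φ (a * x * c) = Q.Φ (a * Q.incl (Q.Φ x) * c) := by
    intro a ha x hx c hc
    obtain ⟨b, y, hy, rfl⟩ := Q.exists_eq_incl_add_of_mem_adjoin hx
    suffices H : Q.Φ (a * y * c) = Q.Φ (a * Q.incl (Q.Φ y) * c) by
      simp only [map_add, mul_add, add_mul, Q.Φ_incl, H]
    induction ha using Submodule.span_induction with
    | mem a ha =>
      induction hc using Submodule.span_induction with
      | mem c hc =>
        obtain ⟨L, hL, hLa, rfl⟩ : ∃ L : List (I × A),
            (∀ q ∈ L, q.2 ∈ Q.generatedSubalgebra (w q.1)) ∧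
            (∀ m (hm : m < L.length), m + 1 = L.length → L[m].1 < k) ∧
            a = (L.map Prod.snd).prod := by
          rcases ha with rfl | ⟨L, y, hL, hy, rfl⟩
          · exact ⟨[], by simp, by simp, by simp⟩
          · refine ⟨L ++ [(i, y)], ?_, ?_, by simp⟩
            · intro q hq
              rcases List.mem_append.mp hq with hq | hq
              · exact hL q hq
              · rw [List.mem_singleton.mp hq]; exact hy
            · intro m hm hm'
              have : m = L.length := by simpa using hm'
              subst this
              simpa using hik
        obtain ⟨L', hL', hLa', rfl⟩ : ∃ L : List (I × A),
            (∀ q ∈ L, q.2 ∈ Q.generatedSubalgebra (w q.1)) ∧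
            (∀ hm : 0 < L.length, L[0].1 < k) ∧ c = (L.map Prod.snd).prod := by
          rcases hc with rfl | ⟨L, y, hL, hy, rfl⟩
          · exact ⟨[], by simp, by simp, by simp⟩
          · refine ⟨(i, y) :: L, ?_, by simpa using hik, by simp⟩
            simp only [List.mem_cons, forall_eq_or_imp]
            exact ⟨hy, hL⟩
        exact MonotoneIndependent.Φ_prod_mul_mul_prod Q h hL hL' hy hLa hLa'
      | zero => simp
      | add c d _ _ hc hd => rw [mul_add, mul_add, map_add, map_add, hc, hd]
      | smul r c _ hc => rw [mul_smul_comm, mul_smul_comm, map_smul, map_smul, hc]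
    | zero => simp
    | add a d _ _ ha hd => simp only [add_mul, map_add, ha, hd]
    | smul r a _ ha => simp only [smul_mul_assoc, map_smul, ha]
  have hΦc : Continuous Q.Φ := Q.ΦL.continuous
  have hic : Continuous Q.incl := Q.inclL.continuous
  have key1 : ∀ a ∈ Submodule.span ℂ (insert 1 (Q.wordsEndingIn w i)),
      ∀ x ∈ Algebra.adjoin ℂ (insert (w k) (range Q.incl)),
      Q.Φ (a * x * c) = Q.Φ (a * Q.incl (Q.Φ x) * c) := fun a ha x hx =>
    closure_minimal (fun c hc => key a ha x hx c hc)
      (isClosed_eq (f := fun c => Q.Φ (a * x * c)) (g := fun c => Q.Φ (a * Q.incl (Q.Φ x) * c))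
        (by fun_prop) (by fun_prop)) hc
  have key2 : ∀ a ∈ Submodule.span ℂ (insert 1 (Q.wordsEndingIn w i)),
      Q.Φ (a * x * c) = Q.Φ (a * Q.incl (Q.Φ x) * c) := fun a ha =>
    closure_minimal (fun x hx => key1 a ha x hx)
      (isClosed_eq (f := fun x => Q.Φ (a * x * c)) (g := fun x => Q.Φ (a * Q.incl (Q.Φ x) * c))
        (by fun_prop) (by fun_prop)) hx
  exact closure_minimal (fun a ha => key2 a ha)
      (isClosed_eq (f := fun a => Q.Φ (a * x * c)) (g := fun a => Q.Φ (a * Q.incl (Q.Φ x) * c))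
        (by fun_prop) (by fun_prop)) ha

end Words

section Subordination

variable {A B : Type*} [CStarAlgebra A] [PartialOrder A] [StarOrderedRing A]
  [CStarAlgebra B] [PartialOrder B] [StarOrderedRing B] [FiniteDimensional ℂ B]
  (Q : QuantumProbabilitySpace A B)

/-- The subordination identity `1 + ψ_{UV} = (1 + ψ_U) ∘ η_V`, from the vanishing of two means of
products which contain the centred resolvent of `V`. The resolvent of `UV` is `R G`, and
`G - T = T (U - 1) (R - Φ(R)) G` where `Φ(R) T` is the resolvent of `U` at `η_V(z)`. -/
theorem resolventMean_mul_of_centred {U V : A} (hU : U ∈ unitary A) (hV : V ∈ unitary A) {z : B}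
    (hz : ‖z‖ < 1) {R G T : A} (hR : R = Ring.inverse (1 - V * Q.incl z))
    (hG : G = (1 - V * Q.incl z) * Ring.inverse (1 - U * V * Q.incl z))
    (hT : T = Q.incl (1 - Q.eta V z) * Ring.inverse (1 - U * Q.incl (Q.eta V z)))
    (h₁ : Q.Φ ((R - Q.incl (Q.Φ R)) * G) = 0)
    (h₂ : Q.Φ (T * (U - 1) * (R - Q.incl (Q.Φ R)) * G) = 0) :
    Q.resolventMean (U * V) z = Q.resolventMean U (Q.eta V z) := by
  set η := Q.eta V z with hη
  set W := Ring.inverse (1 - U * V * Q.incl z) with hW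
  set Y := Ring.inverse (1 - U * Q.incl η) with hY
  set p := Q.Φ R with hp
  have hpV : p = Q.resolventMean V z := by rw [hp, hR, resolventMean]
  have hηn : ‖η‖ < 1 := (Q.norm_eta_le hV hz).trans_lt hz
  have hW1 : (1 - U * V * Q.incl z) * W = 1 :=
    Ring.mul_inverse_cancel _ (Q.isUnit_one_sub_mul_incl (mul_mem hU hV) hz)
  have hY1 : Y * (1 - U * Q.incl η) = 1 :=
    Ring.inverse_mul_cancel _ (Q.isUnit_one_sub_mul_incl hU hηn)
  have hR1 : R * (1 - V * Q.incl z) = 1 := by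
    rw [hR]; exact Ring.inverse_mul_cancel _ (Q.isUnit_one_sub_mul_incl hV hz)
  have hR2 : (1 - V * Q.incl z) * R = 1 := by
    rw [hR]; exact Ring.mul_inverse_cancel _ (Q.isUnit_one_sub_mul_incl hV hz)
  have hp1 : (1 - η) * p = 1 := by
    rw [hη, ← Q.inverse_resolventMean, hpV]
    exact Ring.inverse_mul_cancel _ (Q.isUnit_resolventMean hV hz)
  have hp2 : p * (1 - η) = 1 := by
    rw [hη, ← Q.inverse_resolventMean, hpV]
    exact Ring.mul_inverse_cancel _ (Q.isUnit_resolventMean hV hz)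
  have hip : (1 - Q.incl η) * Q.incl p = 1 := by
    rw [← map_one Q.incl, ← map_sub, ← map_mul, hp1]
  have hRG : R * G = W := by rw [hG, ← mul_assoc, hR1, one_mul]
  have hG1 : G - (U - 1) * (R - 1) * G = 1 := by
    have : R - 1 = V * Q.incl z * R := by
      rw [sub_mul, one_mul] at hR2
      rw [← hR2]; abel
    calc G - (U - 1) * (R - 1) * G = G - (U - 1) * (V * Q.incl z) * (R * G) := by
          rw [this]; noncomm_ring
      _ = (1 - U * V * Q.incl z) * W := by rw [hRG, hG]; noncomm_ring
      _ = 1 := hW1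
  have hT1 : T * (1 - (U - 1) * (Q.incl p - 1)) = 1 := by
    have h3 : 1 - (U - 1) * (Q.incl p - 1) = (1 - U * Q.incl η) * Q.incl p := by
      have h4 : Q.incl η * Q.incl p = Q.incl p - 1 := by
        rw [sub_mul, one_mul] at hip
        rw [← hip]; abel
      calc 1 - (U - 1) * (Q.incl p - 1) = Q.incl p - U * (Q.incl p - 1) := by noncomm_ring
        _ = _ := by rw [← h4]; noncomm_ring
    rw [h3, hT]
    calc Q.incl (1 - η) * Y * ((1 - U * Q.incl η) * Q.incl p)
        = Q.incl (1 - η) * (Y * (1 - U * Q.incl η)) * Q.incl p := by noncomm_ring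
      _ = 1 := by rw [hY1, mul_one, map_sub, map_one, hip]
  have hGT : G - T = T * (U - 1) * (R - Q.incl p) * G := by
    calc G - T = (T * (1 - (U - 1) * (Q.incl p - 1))) * G - T * (G - (U - 1) * (R - 1) * G) := by
          rw [hT1, hG1]; noncomm_ring
      _ = _ := by noncomm_ring
  have hΦG : Q.Φ G = Q.Φ T := by
    rw [← sub_eq_zero, ← map_sub, hGT, h₂]
  calc Q.resolventMean (U * V) z = Q.Φ ((R - Q.incl p) * G + Q.incl p * G) := by
        rw [← add_mul, sub_add_cancel, hRG]; rfl
    _ = p * Q.Φ T := by rw [map_add, h₁, zero_add, Q.Φ_incl_mul, hΦG]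
    _ = Q.Φ Y := by
        rw [← Q.Φ_incl_mul, hT, ← mul_assoc, ← map_mul, hp2, map_one, one_mul]
    _ = Q.resolventMean U η := rfl

end Subordination

end QuantumProbabilitySpace

/-! ### Amplification to matrices -/

namespace CStarMatrix

variable {ι A : Type*} [Fintype ι] [DecidableEq ι] [CStarAlgebra A]

/-- Scalar matrices, as a star algebra homomorphism. -/
def diagonalHom (ι A : Type*) [Fintype ι] [DecidableEq ι] [CStarAlgebra A] :
    A →⋆ₐ[ℂ] CStarMatrix ι ι A where
  toFun a := ofMatrix (Matrix.diagonal fun _ => a)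
  map_one' := congrArg ofMatrix Matrix.diagonal_one
  map_mul' a b := congrArg ofMatrix (Matrix.diagonal_mul_diagonal _ _).symm
  map_zero' := congrArg ofMatrix Matrix.diagonal_zero
  map_add' a b := by
    ext i j
    simp only [ofMatrix_apply, add_apply, Matrix.diagonal_apply]
    split_ifs <;> simp
  commutes' r := by
    ext i j
    simp [algebraMap_apply, Matrix.diagonal_apply]
  map_star' a := by
    ext i j
    simp only [ofMatrix_apply, star_apply, Matrix.diagonal_apply, eq_comm (a := i)]
    split_ifs <;> simp

theorem diagonalHom_apply (a : A) (i j : ι) :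
    diagonalHom ι A a i j = if i = j then a else 0 := rfl

theorem diagonalHom_mul_apply (a : A) (M : CStarMatrix ι ι A) (i j : ι) :
    (diagonalHom ι A a * M) i j = a * M i j := by
  simp [mul_apply, diagonalHom_apply]

theorem mul_diagonalHom_apply (a : A) (M : CStarMatrix ι ι A) (i j : ι) :
    (M * diagonalHom ι A a) i j = M i j * a := by
  simp [mul_apply, diagonalHom_apply]

/-- The subalgebra of the matrices with entries in a given subalgebra. -/
def entriesIn (C : Subalgebra ℂ A) : Subalgebra ℂ (CStarMatrix ι ι A) where
  carrier := {M | ∀ i j, M i j ∈ C}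
  mul_mem' {M N} hM hN i j := by
    rw [mul_apply]
    exact sum_mem fun k _ => mul_mem (hM i k) (hN k j)
  add_mem' {M N} hM hN i j := add_mem (hM i j) (hN i j)
  algebraMap_mem' r i j := by
    rw [algebraMap_apply]
    split_ifs
    · exact C.algebraMap_mem r
    · exact zero_mem _

theorem mem_entriesIn {C : Subalgebra ℂ A} {M : CStarMatrix ι ι A} :
    M ∈ entriesIn C ↔ ∀ i j, M i j ∈ C := Iff.rfl

theorem diagonalHom_mem_entriesIn {C : Subalgebra ℂ A} {a : A} (ha : a ∈ C) :
    diagonalHom ι A a ∈ entriesIn C := by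
  intro p q
  rw [diagonalHom_apply]
  split_ifs
  · exact ha
  · exact zero_mem _

omit [Fintype ι] [DecidableEq ι] in
theorem continuous_entry (i j : ι) : Continuous fun M : CStarMatrix ι ι A => M i j :=
  (continuous_apply j).comp (continuous_apply i)

theorem isClosed_entriesIn {C : Subalgebra ℂ A} (hC : IsClosed (C : Set A)) :
    IsClosed (entriesIn (ι := ι) C : Set (CStarMatrix ι ι A)) := by
  have : (entriesIn (ι := ι) C : Set (CStarMatrix ι ι A)) =
      ⋂ i, ⋂ j, (fun M : CStarMatrix ι ι A => M i j) ⁻¹' C := by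
    ext M; simp [mem_entriesIn]
  rw [this]
  exact isClosed_iInter fun i => isClosed_iInter fun j => hC.preimage (continuous_entry i j)

end CStarMatrix

theorem inverse_one_sub_eq_tsum {A : Type*} [CStarAlgebra A] {x : A} (hx : ‖x‖ < 1) :
    Ring.inverse (1 - x) = ∑' k : ℕ, x ^ k := by
  rw [← mul_one (Ring.inverse (1 - x)),
    Ring.inverse_mul_eq_iff_eq_mul _ _ _ (CStarAlgebra.isUnit_one_sub hx)]
  exact (mul_neg_geom_series x hx).symm

theorem Subalgebra.inverse_one_sub_mem {A : Type*} [CStarAlgebra A] {C : Subalgebra ℂ A}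
    (hC : IsClosed (C : Set A)) {x : A} (hxC : x ∈ C) (hx : ‖x‖ < 1) :
    Ring.inverse (1 - x) ∈ C := by
  rw [inverse_one_sub_eq_tsum hx]
  exact hC.mem_of_tendsto (summable_geometric_of_norm_lt_one hx).hasSum
    (Eventually.of_forall fun s => sum_mem fun k _ => pow_mem hxC k)

/-- The Jordan decomposition, with the negative part written as `e⋆ e`. -/
theorem CStarAlgebra.exists_posPart_negPart {A : Type*} [CStarAlgebra A] [PartialOrder A]
    [StarOrderedRing A] {T : A} (hT : IsSelfAdjoint T) :
    ∃ P e : A, 0 ≤ P ∧ T = P - star e * e ∧ star e * e * P = 0 := by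
  obtain ⟨e, he⟩ := CStarAlgebra.nonneg_iff_eq_star_mul_self.mp (CFC.negPart_nonneg T)
  refine ⟨T⁺, e, CFC.posPart_nonneg T, ?_, ?_⟩
  · rw [← he, CFC.posPart_sub_negPart T hT]
  · rw [← he, CFC.negPart_mul_posPart T]

/-- A selfadjoint matrix over a C⋆-algebra is positive if all the compressions `N⋆ T N` have
positive diagonal entries: for the negative part `N` of `T` the compression is `-N³`. -/
theorem CStarMatrix.nonneg_of_forall_diag {ι B : Type*} [Fintype ι] [DecidableEq ι]
    [CStarAlgebra B] [PartialOrder B] [StarOrderedRing B] {T : CStarMatrix ι ι B}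
    (hT : IsSelfAdjoint T) (h : ∀ (N : CStarMatrix ι ι B) (i : ι), 0 ≤ (star N * T * N) i i) :
    0 ≤ T := by
  obtain ⟨P, e, hP0, hTPN, hNP⟩ := CStarAlgebra.exists_posPart_negPart hT
  obtain ⟨N, he⟩ : ∃ N, N = star e * e := ⟨_, rfl⟩
  rw [← he] at hTPN hNP
  have hNs : star N = N := by rw [he, star_mul, star_star]
  have hTN : star N * T * N = -(N * N * N) := by
    rw [hNs, hTPN]
    calc N * (P - N) * N = N * P * N - N * N * N := by noncomm_ring
      _ = _ := by rw [hNP]; simp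
  have hcube : N * N * N = star (e * N) * (e * N) := by
    rw [star_mul, hNs]
    nth_rewrite 2 [he]
    noncomm_ring
  have hentry : ∀ i, (star (e * N) * (e * N)) i i = ∑ m, star ((e * N) m i) * (e * N) m i := by
    intro i
    simp [mul_apply, star_apply]
  have hzero : e * N = 0 := by
    ext m i
    have h1 := h N i
    rw [hTN, hcube, neg_apply, hentry, Left.nonneg_neg_iff] at h1
    have h2 := (Finset.sum_eq_zero_iff_of_nonneg
      (fun m _ => star_mul_self_nonneg ((e * N) m i))).mp
      (le_antisymm h1 (Finset.sum_nonneg fun m _ => star_mul_self_nonneg _)) m (Finset.mem_univ m)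
    simpa using (CStarRing.star_mul_self_eq_zero_iff _).mp h2
  have hN3 : N * N * N = 0 := by rw [hcube, hzero, mul_zero]
  have hN2 : N * N = 0 := by
    rw [← CStarRing.star_mul_self_eq_zero_iff, star_mul, hNs, ← mul_assoc, hN3, zero_mul]
  have hN1 : N = 0 := by
    rw [← CStarRing.star_mul_self_eq_zero_iff, hNs, hN2]
  rwa [hTPN, hN1, sub_zero]

instance CStarMatrix.instFiniteDimensional {ι B : Type*} [Finite ι] [CStarAlgebra B]
    [FiniteDimensional ℂ B] : FiniteDimensional ℂ (CStarMatrix ι ι B) :=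
  (CStarMatrix.ofMatrixₗ (R := ℂ) (m := ι) (n := ι) (A := B)).finiteDimensional

namespace QuantumProbabilitySpace

variable {A B : Type*} [CStarAlgebra A] [CStarAlgebra B] [PartialOrder B] [StarOrderedRing B]
  (Q : QuantumProbabilitySpace A B) (ι : Type*) [Fintype ι] [DecidableEq ι]

/-- The entrywise inclusion of matrix algebras. -/
def matrixIncl : CStarMatrix ι ι B →⋆ₐ[ℂ] CStarMatrix ι ι A where
  toFun M := M.map Q.incl
  map_one' := by ext i j; simp [CStarMatrix.one_apply, apply_ite Q.incl]
  map_mul' M N := by ext i j; simp [CStarMatrix.mul_apply]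
  map_zero' := by ext i j; simp
  map_add' M N := by ext i j; simp
  commutes' r := by
    ext i j
    simp [CStarMatrix.algebraMap_apply, apply_ite Q.incl, AlgHomClass.commutes]
  map_star' M := by ext i j; simp [CStarMatrix.star_apply, map_star]

theorem matrixIncl_apply (M : CStarMatrix ι ι B) (i j : ι) :
    Q.matrixIncl ι M i j = Q.incl (M i j) := rfl

/-- The entrywise conditional expectation of matrix algebras. -/
def matrixΦ : CStarMatrix ι ι A →ₗ[ℂ] CStarMatrix ι ι B := CStarMatrix.mapₗ Q.Φ

omit [Fintype ι] [DecidableEq ι] in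
theorem matrixΦ_apply (M : CStarMatrix ι ι A) (i j : ι) : Q.matrixΦ ι M i j = Q.Φ (M i j) := rfl

theorem matrixΦ_bimodule (b b' : CStarMatrix ι ι B) (a : CStarMatrix ι ι A) :
    Q.matrixΦ ι (Q.matrixIncl ι b * a * Q.matrixIncl ι b') = b * Q.matrixΦ ι a * b' := by
  ext i j
  simp only [CStarMatrix.mul_apply, matrixΦ_apply, matrixIncl_apply, map_sum, Finset.sum_mul,
    Q.Φ_bimodule]

variable [PartialOrder A] [StarOrderedRing A]

/-- Amplification of a `B`-valued quantum probability space to `ι × ι` matrices. The entrywise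
expectation is positive because it is a bimodule map. -/
def amplification : QuantumProbabilitySpace (CStarMatrix ι ι A) (CStarMatrix ι ι B) where
  incl := Q.matrixIncl ι
  incl_injective := CStarMatrix.map_injective Q.incl_injective
  Φ := Q.matrixΦ ι
  Φ_nonneg a := by
    refine CStarMatrix.nonneg_of_forall_diag ?_ fun N i => ?_
    · ext i j
      simp only [CStarMatrix.star_apply, matrixΦ_apply, ← Q.Φ_star, CStarMatrix.mul_apply, star_sum,
        star_mul, star_star]
    · have h : star N * Q.matrixΦ ι (star a * a) * N =
          Q.matrixΦ ι (star (a * Q.matrixIncl ι N) * (a * Q.matrixIncl ι N)) := by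
        rw [← Q.matrixΦ_bimodule, map_star, star_mul]
        noncomm_ring
      rw [h, matrixΦ_apply, CStarMatrix.mul_apply, map_sum]
      refine Finset.sum_nonneg fun m _ => ?_
      rw [CStarMatrix.star_apply]
      exact Q.Φ_nonneg _
  Φ_one := by
    ext i j
    simp only [matrixΦ_apply, CStarMatrix.one_apply, apply_ite Q.Φ, Q.Φ_one, map_zero]
  Φ_bimodule b b' a := Q.matrixΦ_bimodule ι b b' a

variable {ι}

theorem amplification_Φ_apply (M : CStarMatrix ι ι A) (i j : ι) :
    (Q.amplification ι).Φ M i j = Q.Φ (M i j) := rfl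

/-- Monotone independence for matrices with entries in the closed modules of index `i` and a centred
matrix with entries in the closed algebra of index `k > i`. -/
theorem amplification_Φ_mul_mul_eq_zero {I : Type*} [LinearOrder I] {w : I → A}
    (h : Q.MonotoneIndependent fun i => Q.generatedSubalgebra (w i)) {i k : I} (hik : i < k)
    {a x c : CStarMatrix ι ι A} (ha : ∀ p q, a p q ∈ Q.leftModule w i)
    (hx : x ∈ CStarMatrix.entriesIn
      (Algebra.adjoin ℂ (insert (w k) (range Q.incl))).topologicalClosure)
    (hc : ∀ p q, c p q ∈ Q.rightModule w i) (hΦ : (Q.amplification ι).Φ x = 0) :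
    (Q.amplification ι).Φ (a * x * c) = 0 := by
  ext p q
  rw [amplification_Φ_apply, CStarMatrix.mul_apply, map_sum]
  simp only [CStarMatrix.mul_apply, Finset.sum_mul, map_sum]
  refine Finset.sum_eq_zero fun m _ => Finset.sum_eq_zero fun l _ => ?_
  have h0 : Q.Φ (x l m) = 0 := by
    rw [← amplification_Φ_apply, hΦ]; rfl
  rw [MonotoneIndependent.Φ_mul_mul Q h hik (ha p l) (hx l m) (hc m q), h0]
  simp

end QuantumProbabilitySpace

/-! ### Subordination for matrices -/

namespace QuantumProbabilitySpace

section

variable {A B : Type*} [CStarAlgebra A] [PartialOrder A] [StarOrderedRing A]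
  [CStarAlgebra B] [PartialOrder B] [StarOrderedRing B] [FiniteDimensional ℂ B]
  (Q : QuantumProbabilitySpace A B)

/-- The subordination identity, if centred elements of an algebra `C₁` which contains `V` behave
like letters of higher index with respect to an algebra `C₂` which contains `U` and `V`. -/
theorem resolventMean_mul_of_subalgebras {U V : A} (hU : U ∈ unitary A) (hV : V ∈ unitary A)
    {C₁ C₂ : Subalgebra ℂ A} (hC₁ : IsClosed (C₁ : Set A)) (hC₂ : IsClosed (C₂ : Set A))
    (hB₁ : ∀ b, Q.incl b ∈ C₁) (hB₂ : ∀ b, Q.incl b ∈ C₂) (hV₁ : V ∈ C₁) (hV₂ : V ∈ C₂)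
    (hU₂ : U ∈ C₂)
    (h₁ : ∀ x ∈ C₁, Q.Φ x = 0 → ∀ c ∈ C₂, Q.Φ (x * (1 + (U - 1) * c)) = 0)
    (h₂ : ∀ x ∈ C₁, Q.Φ x = 0 → ∀ a ∈ C₂, ∀ c ∈ C₂,
      Q.Φ (a * (U - 1) * x * (1 + (U - 1) * c)) = 0) {z : B} (hz : ‖z‖ < 1) :
    Q.resolventMean (U * V) z = Q.resolventMean U (Q.eta V z) := by
  have hη : ‖Q.eta V z‖ < 1 := (Q.norm_eta_le hV hz).trans_lt hz
  have hR : Ring.inverse (1 - V * Q.incl z) ∈ C₁ :=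
    Subalgebra.inverse_one_sub_mem hC₁ (mul_mem hV₁ (hB₁ z)) ((Q.norm_mul_incl_le hV z).trans_lt hz)
  have hW : Ring.inverse (1 - U * V * Q.incl z) ∈ C₂ :=
    Subalgebra.inverse_one_sub_mem hC₂ (mul_mem (mul_mem hU₂ hV₂) (hB₂ z))
      ((Q.norm_mul_incl_le (mul_mem hU hV) z).trans_lt hz)
  have hY : Ring.inverse (1 - U * Q.incl (Q.eta V z)) ∈ C₂ :=
    Subalgebra.inverse_one_sub_mem hC₂ (mul_mem hU₂ (hB₂ _)) ((Q.norm_mul_incl_le hU _).trans_lt hη)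
  have hW1 : (1 - U * V * Q.incl z) * Ring.inverse (1 - U * V * Q.incl z) = 1 :=
    Ring.mul_inverse_cancel _ (Q.isUnit_one_sub_mul_incl (mul_mem hU hV) hz)
  have hG : (1 - V * Q.incl z) * Ring.inverse (1 - U * V * Q.incl z) =
      1 + (U - 1) * (V * Q.incl z * Ring.inverse (1 - U * V * Q.incl z)) := by
    generalize Ring.inverse (1 - U * V * Q.incl z) = W at hW1
    calc (1 - V * Q.incl z) * W = (1 - U * V * Q.incl z) * W + (U - 1) * (V * Q.incl z * W) := by
          noncomm_ring
      _ = _ := by rw [hW1]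
  have hc := mul_mem (mul_mem hV₂ (hB₂ z)) hW
  have hcen := sub_mem hR (hB₁ (Q.Φ (Ring.inverse (1 - V * Q.incl z))))
  have hcen0 : Q.Φ (Ring.inverse (1 - V * Q.incl z) -
      Q.incl (Q.Φ (Ring.inverse (1 - V * Q.incl z)))) = 0 := by
    rw [map_sub, Q.Φ_incl, sub_self]
  exact Q.resolventMean_mul_of_centred hU hV hz rfl hG.symm rfl (h₁ _ hcen hcen0 _ hc)
    (h₂ _ hcen hcen0 _ (mul_mem (hB₂ _) hY) _ hc)

end

section

variable {A B : Type*} [CStarAlgebra A] [PartialOrder A] [StarOrderedRing A]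
  [CStarAlgebra B] [PartialOrder B] [StarOrderedRing B] (Q : QuantumProbabilitySpace A B)
  {ι : Type*} [Fintype ι] [DecidableEq ι]

/-- Subordination for matrix amplifications of monotonically independent increments. -/
theorem amplification_resolventMean_mul [FiniteDimensional ℂ B] {I : Type*} [LinearOrder I]
    {w : I → A} (h : Q.MonotoneIndependent fun i => Q.generatedSubalgebra (w i)) {i k : I}
    (hik : i < k) {U V : A} (hU : U ∈ unitary A) (hV : V ∈ unitary A) (hUw : U - 1 = w i)
    (hVw : V - 1 = w k) {z : CStarMatrix ι ι B} (hz : ‖z‖ < 1) :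
    (Q.amplification ι).resolventMean (CStarMatrix.diagonalHom ι A (U * V)) z =
      (Q.amplification ι).resolventMean (CStarMatrix.diagonalHom ι A U)
        ((Q.amplification ι).eta (CStarMatrix.diagonalHom ι A V) z) := by
  have hadj : ∀ x ∈ range w ∪ range Q.incl, x ∈ Q.closedAlgebra w := fun x hx =>
    Subalgebra.le_topologicalClosure _ (Algebra.subset_adjoin hx)
  have hadj₁ : ∀ x ∈ insert (w k) (range Q.incl),
      x ∈ (Algebra.adjoin ℂ (insert (w k) (range Q.incl))).topologicalClosure := fun x hx =>
    Subalgebra.le_topologicalClosure _ (Algebra.subset_adjoin hx)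
  have hUw' : U = w i + 1 := by rw [← hUw, sub_add_cancel]
  have hVw' : V = w k + 1 := by rw [← hVw, sub_add_cancel]
  have hDUw : CStarMatrix.diagonalHom ι A U - 1 = CStarMatrix.diagonalHom ι A (w i) := by
    rw [← hUw, map_sub, map_one]
  have hright : ∀ c ∈ CStarMatrix.entriesIn (ι := ι) (Q.closedAlgebra w), ∀ p q,
      (1 + (CStarMatrix.diagonalHom ι A U - 1) * c) p q ∈ Q.rightModule w i := by
    intro c hc p q
    rw [hDUw, CStarMatrix.add_apply, CStarMatrix.diagonalHom_mul_apply, CStarMatrix.one_apply]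
    refine add_mem ?_ (Q.mul_mem_rightModule i (hc p q))
    split_ifs
    · exact Q.one_mem_rightModule w i
    · exact zero_mem _
  rw [map_mul]
  refine (Q.amplification ι).resolventMean_mul_of_subalgebras
    (C₁ := CStarMatrix.entriesIn
      (Algebra.adjoin ℂ (insert (w k) (range Q.incl))).topologicalClosure)
    (C₂ := CStarMatrix.entriesIn (Q.closedAlgebra w))
    (Unitary.map_mem (CStarMatrix.diagonalHom ι A) hU)
    (Unitary.map_mem (CStarMatrix.diagonalHom ι A) hV)
    (CStarMatrix.isClosed_entriesIn (Subalgebra.isClosed_topologicalClosure _))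
    (CStarMatrix.isClosed_entriesIn (Subalgebra.isClosed_topologicalClosure _))
    (fun b p q => hadj₁ _ (Or.inr ⟨b p q, rfl⟩)) (fun b p q => hadj _ (Or.inr ⟨b p q, rfl⟩))
    (CStarMatrix.diagonalHom_mem_entriesIn ?_) (CStarMatrix.diagonalHom_mem_entriesIn ?_)
    (CStarMatrix.diagonalHom_mem_entriesIn ?_)
    (fun x hx hx0 c hc => ?_) (fun x hx hx0 a ha c hc => ?_) hz
  · rw [hVw']
    exact add_mem (hadj₁ _ (mem_insert _ _)) (one_mem _)
  · rw [hVw']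
    exact add_mem (hadj _ (Or.inl ⟨k, rfl⟩)) (one_mem _)
  · rw [hUw']
    exact add_mem (hadj _ (Or.inl ⟨i, rfl⟩)) (one_mem _)
  · have := Q.amplification_Φ_mul_mul_eq_zero h hik (a := 1) (fun p q => by
      rw [CStarMatrix.one_apply]
      split_ifs
      · exact Q.one_mem_leftModule w i
      · exact zero_mem _) hx (hright c hc) hx0
    rwa [one_mul] at this
  · refine Q.amplification_Φ_mul_mul_eq_zero h hik (fun p q => ?_) hx (hright c hc) hx0
    rw [hDUw, CStarMatrix.mul_diagonalHom_apply]
    exact Q.mul_mem_leftModule i (ha p q)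

end

end QuantumProbabilitySpace

/-! ### Monotone increment processes -/

namespace QuantumProbabilitySpace

section

variable {A B : Type*} [CStarAlgebra A] [PartialOrder A] [StarOrderedRing A]
  [CStarAlgebra B] [PartialOrder B] [StarOrderedRing B]
  (Q : QuantumProbabilitySpace A B)

/-- On unitaries, the moment generating function is the mean of the resolvent minus `1`. -/
theorem psiTransform_distribution {U : A} (hU : U ∈ unitary A) {n : ℕ}
    {z : CStarMatrix (Fin n) (Fin n) B} (hz : ‖z‖ < 1) :
    psiTransform (Q.distribution U) n z =
      (Q.amplification (Fin n)).resolventMean (CStarMatrix.diagonalHom (Fin n) A U) z - 1 := by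
  set Q' := Q.amplification (Fin n) with hQ'
  set x := CStarMatrix.diagonalHom (Fin n) A U * Q'.incl z with hx
  have hxn : ‖x‖ < 1 :=
    (Q'.norm_mul_incl_le (Unitary.map_mem (CStarMatrix.diagonalHom (Fin n) A) hU) z).trans_lt hz
  have hterm : ∀ m : ℕ, CStarMatrix.ofMatrix
      (((Matrix.of fun i j => NCPoly.X * NCPoly.C (z i j)) ^ (m + 1)).map (Q.distribution U)) =
      Q'.ΦL (x ^ (m + 1)) := by
    intro m
    have h1 : x = CStarMatrix.ofMatrixRingEquiv
        ((NCPoly.eval (Q.incl : B →ₐ[ℂ] A) U).mapMatrix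
          (Matrix.of fun i j => NCPoly.X * NCPoly.C (z i j))) := by
      ext i j
      rw [hx, CStarMatrix.diagonalHom_mul_apply]
      change _ = NCPoly.eval (Q.incl : B →ₐ[ℂ] A) U (NCPoly.X * NCPoly.C (z i j))
      rw [map_mul, NCPoly.eval_X, NCPoly.eval_C]
      rfl
    rw [h1, ← map_pow CStarMatrix.ofMatrixRingEquiv,
      ← map_pow (NCPoly.eval (Q.incl : B →ₐ[ℂ] A) U).mapMatrix]
    rfl
  have hs : Summable fun m : ℕ => x ^ m := summable_geometric_of_norm_lt_one hxn
  have hs' : Summable fun m : ℕ => x ^ (m + 1) := (summable_nat_add_iff 1).mpr hs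
  have hR : Ring.inverse (1 - x) = 1 + ∑' m : ℕ, x ^ (m + 1) := by
    rw [inverse_one_sub_eq_tsum hxn, hs.tsum_eq_zero_add, pow_zero]
  rw [psiTransform, tsum_congr hterm, ← Q'.ΦL.map_tsum hs', resolventMean, ← hx, hR, map_add,
    Q'.Φ_one, add_sub_cancel_left, Q'.ΦL_apply]

/-- On unitaries, the `η`-transform is that of the matrix amplification. -/
theorem etaTransform_distribution [FiniteDimensional ℂ B] {U : A} (hU : U ∈ unitary A) {n : ℕ}
    {z : CStarMatrix (Fin n) (Fin n) B} (hz : ‖z‖ < 1) :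
    etaTransform (Q.distribution U) n z =
      (Q.amplification (Fin n)).eta (CStarMatrix.diagonalHom (Fin n) A U) z := by
  have h := Ring.mul_inverse_cancel _ ((Q.amplification (Fin n)).isUnit_resolventMean
    (Unitary.map_mem (CStarMatrix.diagonalHom (Fin n) A) hU) hz)
  rw [etaTransform, Q.psiTransform_distribution hU hz, add_sub_cancel, sub_mul, h, one_mul, eta]

theorem amplification_Φ_diagonalHom (ι : Type*) [Fintype ι] [DecidableEq ι] {a : A} {c : ℝ}
    (h : Q.Φ a = algebraMap ℝ B c) :
    (Q.amplification ι).Φ (CStarMatrix.diagonalHom ι A a) =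
      algebraMap ℝ (CStarMatrix ι ι B) c := by
  ext i j
  rw [amplification_Φ_apply, CStarMatrix.diagonalHom_apply, apply_ite Q.Φ, h, map_zero,
    Algebra.algebraMap_eq_smul_one, Algebra.algebraMap_eq_smul_one, CStarMatrix.smul_apply,
    CStarMatrix.one_apply, smul_ite, smul_zero]

end

section

variable {A B : Type*} [CStarAlgebra A] [CStarAlgebra B] [PartialOrder B] [StarOrderedRing B]
  {Q : QuantumProbabilitySpace A B} {U : ℝ → A} (hU : Q.IsNUMIP U)
include hU

/-- The two successive increments of a process at three given times, in the order of the times. -/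
theorem IsNUMIP.increments_pair {r s t : ℝ} (hr : 0 ≤ r) (hrs : r ≤ s) (hst : s ≤ t) :
    Q.MonotoneIndependent fun i : Fin 2 => Q.generatedSubalgebra
      (![star (U r) * U s - 1, star (U s) * U t - 1] i) := by
  have h := hU.increments 2 ![r, s, t] hr (by
    rw [Fin.monotone_iff_le_succ]
    intro i
    fin_cases i
    · exact hrs
    · exact hst)
  convert h using 2 with i
  fin_cases i <;> rfl

theorem IsNUMIP.increment_mem_unitary {s t : ℝ} (hs : 0 ≤ s) (hst : s ≤ t) :
    star (U s) * U t ∈ _root_.unitary A :=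
  mul_mem (Unitary.star_mem (hU.unitary s hs)) (hU.unitary t (hs.trans hst))

theorem IsNUMIP.increment_mul_increment {r s : ℝ} (hr : 0 ≤ r) (hrs : r ≤ s) (t : ℝ) :
    star (U r) * U s * (star (U s) * U t) = star (U r) * U t := by
  rw [mul_assoc, ← mul_assoc (U s), Unitary.mul_star_self_of_mem (hU.unitary s (hr.trans hrs)),
    one_mul]

/-- The increments have scalar means: `Φ(U_t) = Φ(U_s) Φ(U_s⋆ U_t)` by monotone independence. -/
theorem IsNUMIP.mean_increment {s t : ℝ} (hs : 0 ≤ s) (hst : s ≤ t) :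
    Q.Φ (star (U s) * U t) = algebraMap ℝ B (Real.exp (-(t - s))) := by
  have h := hU.increments_pair le_rfl hs hst
  have h1 := MonotoneIndependent.Φ_prod_mul_mul_prod Q h (L := [(0, U s - 1)]) (L' := []) (i := 1)
    (x := star (U s) * U t - 1)
    (by
      intro q hq
      rw [List.mem_singleton.mp hq]
      simpa [hU.initial] using Q.self_mem_generatedSubalgebra (U s - 1))
    (by simp) (Q.self_mem_generatedSubalgebra _) (by simp) (by simp)
  have hmean : ∀ t, 0 ≤ t → Q.Φ (U t) = Real.exp (-t) • (1 : B) := fun t ht => by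
    rw [hU.mean t ht, Algebra.algebraMap_eq_smul_one, Complex.coe_smul]
  have hUV : U s * (star (U s) * U t) = U t := by
    rw [← mul_assoc, Unitary.mul_star_self_of_mem (hU.unitary s hs), one_mul]
  have h2 : Q.Φ (U t) = Q.Φ (U s) * Q.Φ (star (U s) * U t) := by
    simp only [List.map_cons, List.map_nil, List.prod_cons, List.prod_nil, mul_one] at h1
    rw [Q.Φ_mul_incl, sub_mul, mul_sub, hUV] at h1
    simp only [map_sub, Q.Φ_one, sub_mul, mul_sub, mul_one, one_mul] at h1
    have h3 := sub_eq_zero.mpr h1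
    rw [← sub_eq_zero, ← h3]
    abel
  rw [hmean t (hs.trans hst), hmean s hs, smul_mul_assoc, one_mul] at h2
  rw [Algebra.algebraMap_eq_smul_one, show -(t - s) = s + -t by ring, Real.exp_add, mul_smul, h2,
    smul_smul, ← Real.exp_add, add_neg_cancel, Real.exp_zero, one_smul]

variable [PartialOrder A] [StarOrderedRing A]

/-- The `η`-transforms of the increments of a process form an evolution family. -/
theorem IsNUMIP.isEvolutionFamily [FiniteDimensional ℂ B] (n : ℕ) :
    IsEvolutionFamily fun s t => (Q.amplification (Fin n)).eta
      (CStarMatrix.diagonalHom (Fin n) A (star (U s) * U t)) := by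
  refine (Q.amplification (Fin n)).isEvolutionFamily_eta
    (V := fun s t => CStarMatrix.diagonalHom (Fin n) A (star (U s) * U t))
    (fun s t hs hst => Unitary.map_mem _ (hU.increment_mem_unitary hs hst))
    (fun s hs => by rw [Unitary.star_mul_self_of_mem (hU.unitary s hs), map_one])
    (fun s t hs hst => Q.amplification_Φ_diagonalHom _ (hU.mean_increment hs hst))
    (fun r s t hr hrs hst z hz => ?_)
  rw [← hU.increment_mul_increment hr hrs t]
  exact Q.amplification_resolventMean_mul (hU.increments_pair hr hrs hst)
    (i := 0) (k := 1) (by simp) (hU.increment_mem_unitary hr hrs)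
    (hU.increment_mem_unitary (hr.trans hrs) hst) rfl rfl hz

end

end QuantumProbabilitySpace

end

theorem theorem4p6 {A B : Type*} [CStarAlgebra A]
    [CStarAlgebra B] [PartialOrder B] [StarOrderedRing B] [FiniteDimensional ℂ B]
    (Q : QuantumProbabilitySpace A B) (U : ℝ → A) (hU : Q.IsNUMIP U)
    (μ : ℝ → NCPoly B →ₗ[ℂ] B) (hμ : ∀ t, 0 ≤ t → μ t = Q.distribution (U t)) (n : ℕ) :
    IsNormalizedDecreasingLoewnerChain (fun t => etaTransform (μ t) n) ∧
    (∃ M : CStarMatrix (Fin n) (Fin n) B → ℝ → CStarMatrix (Fin n) (Fin n) B,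
      IsHerglotzVectorField M ∧ SolvesLoewnerPDE (fun t => etaTransform (μ t) n) M) ∧
    ∀ t, 0 ≤ t →
      IsBiholomorphicOntoImage (etaTransform (μ t) n)
        (Metric.ball (0 : CStarMatrix (Fin n) (Fin n) B) 1) := by
  -- the order of `A`, which is determined by its C⋆-structure
  let := CStarAlgebra.spectralOrder A
  have := CStarAlgebra.spectralOrderedRing A
  obtain ⟨hchain, hpde⟩ := (hU.isEvolutionFamily n).loewner
    (f := fun t => etaTransform (μ t) n) fun t ht z hz => by
      simp only [hμ t ht, hU.initial, star_one, one_mul]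
      exact Q.etaTransform_distribution (hU.unitary t ht) (mem_ball_zero_iff.mp hz)
  exact ⟨hchain, hpde, hchain.biholomorphic⟩
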